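/- Let $G$ be a compact connected Lie group with Lie algebra $\mathfrak g$ (the left-invariant vector fields on $G$, identified with $T_eG$), and let $X_1,\dots,X_m\in\mathfrak g$. A \emph{trajectory} of the left-invariant driftless system $$\mathbf x'=\sum_{k=1}^m u_kX_k(\mathbf x)\qquad(\ast)$$ is a tuple $(\mathbf x,u_1,\dots,u_m)$, where $u_1,\dots,u_m:\mathbb R\to\mathbb R$ are smooth and $\mathbf x:\mathbb R\to G$ satisfies $\mathbf x'(t)=\sum_k u_k(t)X_k(\mathbf x(t))$ for all $t\in\mathbb R$. Let $(\mathbf x_r,u_1^r,\dots,u_m^r)$ be a trajectory of $(\ast)$ that is $T$-periodic for some $T>0$ (all of $\mathbf x_r,u^r_1,\dots,u^r_m$ are $T$-periodic) and \emph{regular}, that is, $$\operatorname{span}\{\operatorname{Ad}(\mathbf x_r(t))X_k \;;\; t\in\mathbb R,\ 1\le k\le m\}=\mathfrak g.$$ Put $V(x)=\operatorname{tr}\operatorname{Ad}(x)$ for $x\in G$ and define, for $(t,w)\in\mathbb R\times G$, $$a_k(t,w)=\mathrm dV\big((\operatorname{Ad}(\mathbf x_r(t))X_k)(w)\big),\qquad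 W(t,w)=\sum_{k=1}^m a_k(t,w)\,(\operatorname{Ad}(\mathbf x_r(t))X_k)(w).$$ A point $x\in G$ is a \emph{local attractor} of the time-dependent vector field $W$ if $W(t,x)=0$ for all $t\in\mathbb R$ and there is a neighborhood $U$ of $x$ such that, for every $(t_0,w_0)\in\mathbb R\times U$, there is a unique integral curve $\mathbf w:\mathbb R\to G$ of $W$ with $\mathbf w(t_0)=w_0$, and it satisfies $\lim_{t\to\infty}\mathbf w(t)=x$. Assume that $G$ is semisimple (i.e. $\mathfrak g$ has no nonzero solvable ideal). Then: 1. every $x$ in the center $Z(G)$ is a local attractor of $W$; in particular, the identity $e$ is a local attractor of $W$; 2. there is a neighborhood $U_\infty$ of $\mathbf x_r(0)$ such that for every $x_0\in U_\infty$ there is a unique integral curve $\mathbf w:\mathbb R\to G$ of $W$ with $\mathbf w(0)=x_0\,\mathbf x_r(0)^{-1}$, and, setting $\mathbf x(t)=\mathbf w(t)\,\mathbf x_r(t)$ and $u_k(t)=a_k(t,\mathbf w(t))+u_k^r(t)$, the tuple $(\mathbf x,u_1,\dots,u_m)$ is a trajectory of $(\ast)$ with $\mathbf x(0)=x_0$ and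 $\lim_{t\to\infty}\mathbf x(t)\,\mathbf x_r(t)^{-1}=e$. -/

import Mathlib

open scoped Manifold ContDiff Topology

/-- A smooth real Lie group is in particular as smooth as needed for Mathlib's Lie bracket on its
tangent space at the identity. -/
instance instLEInftyMinSmoothnessRealThree : ENat.LEInfty (minSmoothness ℝ 3) :=
  ⟨by rw [minSmoothness_of_isRCLikeNormedField]; exact ENat.LEInfty.out⟩

namespace TrajectoryTracking

noncomputable section

variable {E : Type*} [NormedAddCommGroup E] [NormedSpace ℝ E]
  {H : Type*} [TopologicalSpace H] (I : ModelWithCorners ℝ E H)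
  {G : Type*} [TopologicalSpace G] [ChartedSpace H G] [Group G]

/-- `γ` is a (global) integral curve of the time-dependent vector field `Y`:
`γ' t = Y t (γ t)` for every `t`. -/
def IsIntegralCurve (Y : ℝ → (x : G) → TangentSpace I x) (γ : ℝ → G) : Prop :=
  ∀ t : ℝ, HasMFDerivAt 𝓘(ℝ, ℝ) I γ t ((1 : ℝ →L[ℝ] ℝ).smulRight (Y t (γ t)))

/-- `x` is a critical point of the time-dependent vector field `Y`. -/
def IsCriticalPoint (Y : ℝ → (x : G) → TangentSpace I x) (x : G) : Prop :=
  ∀ t : ℝ, Y t x = 0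

/-- `x` is a local attractor of the time-dependent vector field `Y`: it is a critical point, and it
has a neighbourhood `U` such that for every initial time `t₀` and initial state `x₀ ∈ U` there is
one and only one integral curve `γ` of `Y`, defined for all times, with `γ t₀ = x₀`, and this
curve satisfies `γ t → x` as `t → ∞`. -/
def IsLocalAttractor (Y : ℝ → (x : G) → TangentSpace I x) (x : G) : Prop :=
  IsCriticalPoint I Y x ∧
    ∃ U ∈ 𝓝 x, ∀ t₀ : ℝ, ∀ x₀ ∈ U,
      (∃! γ : ℝ → G, IsIntegralCurve I Y γ ∧ γ t₀ = x₀) ∧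
      ∀ γ : ℝ → G, IsIntegralCurve I Y γ → γ t₀ = x₀ → Filter.Tendsto γ Filter.atTop (𝓝 x)

/-- The adjoint map `Ad x : 𝔤 → 𝔤`, the differential at the identity of `y ↦ x * y * x⁻¹`
(the tangent spaces at `x * 1 * x⁻¹` and at `1` are the same). -/
def Ad (x : G) : GroupLieAlgebra I G →ₗ[ℝ] GroupLieAlgebra I G :=
  (mfderiv I I (fun y : G => x * y * x⁻¹) (1 : G) : E →L[ℝ] E).toLinearMap

/-- The Lyapunov-like function `V x = tr (Ad x)`. -/
def lyapunov (x : G) : ℝ :=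
  LinearMap.trace ℝ (GroupLieAlgebra I G) (Ad I x)

variable {m : ℕ}

/-- `(x, u₁, …, uₘ)` is a (smooth) trajectory of the left-invariant driftless system
`x' = ∑ k, uₖ Xₖ(x)`. A vector of `𝔤 = T_e G` stands for the left-invariant vector field it
generates. -/
structure IsTrajectory (X : Fin m → GroupLieAlgebra I G) (x : ℝ → G) (u : Fin m → ℝ → ℝ) :
    Prop where
  smooth : ∀ k, ContDiff ℝ ∞ (u k)
  integralCurve :
    IsIntegralCurve I (fun t y => ∑ k, u k t • mulInvariantVectorField (I := I) (X k) y) x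

/-- `x` and all the controls `u k` are `T`-periodic. -/
def IsPeriodicTrajectory (T : ℝ) (x : ℝ → G) (u : Fin m → ℝ → ℝ) : Prop :=
  Function.Periodic x T ∧ ∀ k, Function.Periodic (u k) T

/-- Regularity: the vectors `Ad (x t) Xₖ`, for all `t` and `k`, span the Lie algebra. -/
def IsRegular (X : Fin m → GroupLieAlgebra I G) (x : ℝ → G) : Prop :=
  Submodule.span ℝ {v : GroupLieAlgebra I G | ∃ (t : ℝ) (k : Fin m), v = Ad I (x t) (X k)} = ⊤

/-- The coefficient `aₖ(t, w) = dV (Ad (xr t) Xₖ (w))`. -/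
def auxCoeff (X : Fin m → GroupLieAlgebra I G) (xr : ℝ → G) (k : Fin m) (t : ℝ) (w : G) : ℝ :=
  mvfderiv I (lyapunov I : G → ℝ) w
    (mulInvariantVectorField (I := I) (Ad I (xr t) (X k)) w)

/-- The auxiliary vector field `W(t, w) = ∑ k, aₖ(t, w) Ad (xr t) Xₖ (w)`. -/
def auxField (X : Fin m → GroupLieAlgebra I G) (xr : ℝ → G) (t : ℝ) (w : G) : TangentSpace I w :=
  ∑ k, auxCoeff I X xr k t w • mulInvariantVectorField (I := I) (Ad I (xr t) (X k)) w

/-- `(x, u₁, …, uₘ)` solves the tracking problem for the reference curve `xr` and the initial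
state `x₀`. -/
structure SolvesTracking (X : Fin m → GroupLieAlgebra I G) (xr : ℝ → G) (x₀ : G)
    (x : ℝ → G) (u : Fin m → ℝ → ℝ) : Prop where
  trajectory : IsTrajectory I X x u
  initial : x 0 = x₀
  tracks : Filter.Tendsto (fun t => x t * (xr t)⁻¹) Filter.atTop (𝓝 1)

end

end TrajectoryTracking

/-!
Averaging an inner product over the compact group `G` makes every `Ad x` orthogonal. Hence
`V = tr ∘ Ad` is at most `dim 𝔤`, with equality exactly where `Ad x = id`, and at such points its
Hessian is the Killing form `X ↦ tr ((ad X)²)`. As `ad X` is skew for the invariant inner product,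
the Hessian is negative definite as soon as `𝔤` has trivial center, so these points are isolated
critical points of `V`.

Along an integral curve of `W` one has `(V ∘ w)' = ∑ k, a k ^ 2`. So `V ∘ w` increases, which traps
the curves that start close to a strict maximum of `V`, and by Barbalat's lemma every `a k` tends to
zero. The velocity then tends to zero as well, so by periodicity `dV` is asymptotically zero at
`w t` in every direction `Ad (xr s) (X k)`, and regularity turns this into `dV → 0` along `w`: limit
points of `w` are critical points of `V`. Near a strict maximum that is an isolated critical point
this forces convergence. Finally `w * xr` is a trajectory by the product rule.
-/

namespace TrajectoryTracking

noncomputable section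

section Matrices

variable {n : Type*} [Fintype n]

lemma trace_le_card_of_mem_orthogonalGroup [DecidableEq n] {M : Matrix n n ℝ}
    (hM : M ∈ Matrix.orthogonalGroup n ℝ) : M.trace ≤ Fintype.card n :=
  calc M.trace = ∑ i, M i i := rfl
    _ ≤ ∑ _i : n, (1 : ℝ) := Finset.sum_le_sum fun i _ =>
      (Real.le_norm_self _).trans (entry_norm_bound_of_unitary hM i i)
    _ = Fintype.card n := by simp

lemma eq_zero_of_transpose_eq_neg_of_trace_mul_self_eq_zero {M : Matrix n n ℝ}
    (hM : M.transpose = -M) (htr : (M * M).trace = 0) : M = 0 := by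
  rw [← Matrix.trace_conjTranspose_mul_self_eq_zero_iff,
    Matrix.conjTranspose_eq_transpose_of_trivial, hM, neg_mul, Matrix.trace_neg, htr, neg_zero]

end Matrices

section Endomorphisms

variable {E : Type*} [NormedAddCommGroup E] [NormedSpace ℝ E]

variable (E) in
/-- The trace as a continuous linear form on the continuous endomorphisms of a
finite-dimensional space. -/
def traceCLM [FiniteDimensional ℝ E] : (E →L[ℝ] E) →L[ℝ] ℝ :=
  LinearMap.toContinuousLinearMap (LinearMap.trace ℝ E ∘ₗ ContinuousLinearMap.coeLM ℝ)

lemma traceCLM_apply [FiniteDimensional ℝ E] (A : E →L[ℝ] E) :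
    traceCLM E A = LinearMap.trace ℝ E (A : E →ₗ[ℝ] E) := rfl

variable {ι : Type*} [Fintype ι] [DecidableEq ι] (b : Module.Basis ι ℝ E)

lemma traceCLM_le_finrank_of_toMatrix_mem_orthogonalGroup [FiniteDimensional ℝ E] {A : E →L[ℝ] E}
    (hA : LinearMap.toMatrix b b A ∈ Matrix.orthogonalGroup ι ℝ) :
    traceCLM E A ≤ Module.finrank ℝ E := by
  rw [traceCLM_apply, LinearMap.trace_eq_matrix_trace ℝ b, Module.finrank_eq_card_basis b]
  exact trace_le_card_of_mem_orthogonalGroup hA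

lemma eq_zero_of_toMatrix_transpose_eq_neg_of_traceCLM_mul_self_eq_zero [FiniteDimensional ℝ E]
    {A : E →L[ℝ] E} (hA : (LinearMap.toMatrix b b A).transpose = -LinearMap.toMatrix b b A)
    (htr : traceCLM E (A * A) = 0) : A = 0 := by
  rw [traceCLM_apply, LinearMap.trace_eq_matrix_trace ℝ b, ContinuousLinearMap.mul_def,
    ContinuousLinearMap.toLinearMap_comp, LinearMap.toMatrix_comp b b b] at htr
  have h := eq_zero_of_transpose_eq_neg_of_trace_mul_self_eq_zero hA htr
  rw [LinearEquiv.map_eq_zero_iff] at h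
  exact ContinuousLinearMap.coe_injective h

lemma toMatrix_transpose_eq_neg_of_hasFDerivAt {F : Type*} [NormedAddCommGroup F]
    [NormedSpace ℝ F] {A : F → E →L[ℝ] E} {A' : F →L[ℝ] E →L[ℝ] E} {x : F}
    (hA : ∀ᶠ y in 𝓝 x, LinearMap.toMatrix b b (A y) ∈ Matrix.orthogonalGroup ι ℝ) (hx : A x = 1)
    (hA' : HasFDerivAt A A' x) (v : F) :
    (LinearMap.toMatrix b b (A' v)).transpose = -LinearMap.toMatrix b b (A' v) := by
  have := b.finiteDimensional_of_finite
  ext i j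
  let entry (k l : ι) : (E →L[ℝ] E) →L[ℝ] ℝ :=
    (LinearMap.toContinuousLinearMap (b.coord k)).comp (ContinuousLinearMap.apply ℝ E (b l))
  have hentry (k l : ι) (B : E →L[ℝ] E) : LinearMap.toMatrix b b B k l = entry k l B :=
    LinearMap.toMatrix_apply ..
  have hone (k l : ι) : entry k l 1 = if k = l then 1 else 0 := by
    simp [← hentry, Matrix.one_apply]
  have horth : (fun y => ∑ k, entry k i (A y) * entry k j (A y)) =ᶠ[𝓝 x]
      fun _ => (1 : Matrix ι ι ℝ) i j := by
    filter_upwards [hA] with y hy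
    rw [← (Matrix.mem_orthogonalGroup_iff' ι ℝ).1 hy]
    simp [Matrix.mul_apply, hentry]
  have hderiv := HasFDerivAt.fun_sum (u := Finset.univ) fun k _ =>
    ((entry k i).hasFDerivAt.comp x hA').mul ((entry k j).hasFDerivAt.comp x hA')
  have hsum : entry i j (A' v) + entry j i (A' v) = 0 := by
    simpa [hx, hone, Finset.sum_add_distrib] using DFunLike.congr_fun
      (hderiv.unique ((hasFDerivAt_const _ x).congr_of_eventuallyEq horth)) v
  simpa only [Matrix.transpose_apply, Matrix.neg_apply, hentry] using
    eq_neg_of_add_eq_zero_right hsum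

end Endomorphisms

section CompactGroupRepresentations

lemma exists_basis_forall_toMatrix_mem_orthogonalGroup {V : Type*} [AddCommGroup V] [Module ℝ V]
    [FiniteDimensional ℝ V] (c : InnerProductSpace.Core ℝ V) :
    ∃ b : Module.Basis (Fin (Module.finrank ℝ V)) ℝ V,
      ∀ A : V →ₗ[ℝ] V, (∀ u v, c.inner (A u) (A v) = c.inner u v) →
        LinearMap.toMatrix b b A ∈ Matrix.orthogonalGroup _ ℝ := by
  let : NormedAddCommGroup V := c.toNormedAddCommGroup
  let : InnerProductSpace ℝ V := InnerProductSpace.ofCore c.toCore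
  let b := stdOrthonormalBasis ℝ V
  exact ⟨b.toBasis, fun A hA =>
    ((A.isometryOfInner hA).toLinearIsometryEquiv rfl).toMatrix_mem_unitaryGroup b b⟩

open MeasureTheory

variable {E : Type*} [NormedAddCommGroup E] [NormedSpace ℝ E] [FiniteDimensional ℝ E]
  {G : Type*} [TopologicalSpace G] [Group G] [IsTopologicalGroup G]
  {ρ : G →* (E →L[ℝ] E)}

lemma continuous_inner_toEuclidean_inv (hρ : Continuous ρ) (u v : E) :
    Continuous fun g : G => inner ℝ (toEuclidean (ρ g⁻¹ u)) (toEuclidean (ρ g⁻¹ v)) := by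
  have : Continuous fun g : G => ρ g⁻¹ := hρ.comp continuous_inv
  fun_prop

variable [CompactSpace G]

section Averaging

variable [MeasurableSpace G] [BorelSpace G]

variable (ρ) in
/-- The average over the compact group `G` of the translates of the Euclidean inner product of
`E` under the representation `ρ`. -/
def averagedInner (u v : E) : ℝ :=
  ∫ g : G, inner ℝ (toEuclidean (ρ g⁻¹ u)) (toEuclidean (ρ g⁻¹ v)) ∂Measure.haar

lemma integrable_inner_toEuclidean_inv (hρ : Continuous ρ) (u v : E) :
    Integrable (fun g : G => inner ℝ (toEuclidean (ρ g⁻¹ u)) (toEuclidean (ρ g⁻¹ v)))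
      Measure.haar :=
  (continuous_inner_toEuclidean_inv hρ u v).integrable_of_hasCompactSupport
    (HasCompactSupport.of_compactSpace _)

lemma averagedInner_map_map (x : G) (u v : E) :
    averagedInner ρ (ρ x u) (ρ x v) = averagedInner ρ u v := by
  unfold averagedInner
  rw [← integral_mul_left_eq_self _ x]
  congr! 4 with g <;> simp [← mul_apply_eq_comp, ← map_mul]

lemma averagedInner_self_pos (hρ : Continuous ρ) {u : E} (hu : u ≠ 0) :
    0 < averagedInner ρ u u := by
  refine (continuous_inner_toEuclidean_inv hρ u u).integral_pos_of_hasCompactSupport_nonneg_nonzero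
    (x := 1) (HasCompactSupport.of_compactSpace _) (fun g => real_inner_self_nonneg) ?_
  simpa using hu

end Averaging

lemma exists_invariant_innerCore (hρ : Continuous ρ) :
    ∃ c : InnerProductSpace.Core ℝ E, ∀ g u v, c.inner (ρ g u) (ρ g v) = c.inner u v := by
  let : MeasurableSpace G := borel G
  have : BorelSpace G := ⟨rfl⟩
  let c : InnerProductSpace.Core ℝ E :=
    { inner := averagedInner ρ
      conj_inner_symm := fun u v => by simp [averagedInner, real_inner_comm]
      re_inner_nonneg := fun u => integral_nonneg fun _ => real_inner_self_nonneg
      add_left := fun u v w => by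
        simp only [averagedInner, map_add, inner_add_left]
        exact integral_add (integrable_inner_toEuclidean_inv hρ u w)
          (integrable_inner_toEuclidean_inv hρ v w)
      smul_left := fun u v r => by
        simp [averagedInner, real_inner_smul_left, integral_const_mul]
      definite := fun u h => by
        by_contra hu
        exact (averagedInner_self_pos hρ hu).ne' h }
  exact ⟨c, averagedInner_map_map⟩

theorem exists_basis_toMatrix_mem_orthogonalGroup (hρ : Continuous ρ) :
    ∃ b : Module.Basis (Fin (Module.finrank ℝ E)) ℝ E,
      ∀ g, LinearMap.toMatrix b b (ρ g) ∈ Matrix.orthogonalGroup _ ℝ := by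
  obtain ⟨c, hc⟩ := exists_invariant_innerCore hρ
  obtain ⟨b, hb⟩ := exists_basis_forall_toMatrix_mem_orthogonalGroup c
  exact ⟨b, fun g => hb (ρ g) (hc g)⟩

end CompactGroupRepresentations

section Composition

variable {E E' E'' H H' H'' M M' M'' : Type*} [NormedAddCommGroup E] [NormedSpace ℝ E]
  [NormedAddCommGroup E'] [NormedSpace ℝ E'] [NormedAddCommGroup E''] [NormedSpace ℝ E'']
  [TopologicalSpace H] [TopologicalSpace H'] [TopologicalSpace H'']
  {I : ModelWithCorners ℝ E H} {I' : ModelWithCorners ℝ E' H'} {I'' : ModelWithCorners ℝ E'' H''}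
  [TopologicalSpace M] [ChartedSpace H M] [TopologicalSpace M'] [ChartedSpace H' M']
  [TopologicalSpace M''] [ChartedSpace H'' M'']

lemma hasMFDerivAt_comp_of_eq {f : M → M'} {g : M' → M''} {x : M} {y : M'} {L' : E' →L[ℝ] E''}
    {L : E →L[ℝ] E'} (hg : HasMFDerivAt I' I'' g y L') (hf : HasMFDerivAt I I' f x L)
    (hy : f x = y) : HasMFDerivAt I I'' (g ∘ f) x (L'.comp L) := by
  subst hy
  exact hg.comp x hf

end Composition

section AdjointRepresentation

variable {E : Type*} [NormedAddCommGroup E] [NormedSpace ℝ E]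
  {H : Type*} [TopologicalSpace H] (I : ModelWithCorners ℝ E H)
  {G : Type*} [TopologicalSpace G] [ChartedSpace H G] [Group G]

/-- The differential at the identity of left multiplication by `x`, as an endomorphism of the
model space; it sends `Y` to the value at `x` of the left-invariant vector field of `Y`. -/
def mulLeftDeriv (x : G) : E →L[ℝ] E := mfderiv I I (fun y : G => x * y) (1 : G)

lemma mulLeftDeriv_one : mulLeftDeriv I (1 : G) = ContinuousLinearMap.id ℝ E := by
  have hmul : (fun y : G => 1 * y) = id := funext one_mul
  unfold mulLeftDeriv
  rw [hmul]
  exact mfderiv_id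

lemma Ad_eq_id_of_mem_center {z : G} (hz : z ∈ Subgroup.center G) : Ad I z = LinearMap.id := by
  have hconj : (fun y : G => z * y * z⁻¹) = id := by
    ext y
    simp [← Subgroup.mem_center_iff.1 hz y]
  unfold Ad
  rw [hconj]
  exact congrArg ContinuousLinearMap.toLinearMap (mfderiv_id (I := I) (x := (1 : G)))

variable [LieGroup I ∞ G]

lemma hasMFDerivAt_mul_left (x : G) :
    HasMFDerivAt I I (fun y : G => x * y) (1 : G) (mulLeftDeriv I x : E →L[ℝ] E) := by
  have hsmooth : ContMDiff I I ∞ (fun y : G => x * y) := contMDiff_const.mul contMDiff_id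
  exact (hsmooth.mdifferentiable (by simp) 1).hasMFDerivAt

lemma mdifferentiable_conj (x : G) : MDifferentiable I I (fun y : G => x * y * x⁻¹) := by
  have hsmooth : ContMDiff I I ∞ (fun y : G => x * y * x⁻¹) :=
    (contMDiff_const.mul contMDiff_id).mul contMDiff_const
  exact hsmooth.mdifferentiable (by simp)

/-- The adjoint representation `Ad` with values in the continuous endomorphisms of the model
space, where differential calculus is available: Mathlib puts no norm on `T_e G`. -/
def adRep : G →* (E →L[ℝ] E) where
  toFun x := mfderiv I I (fun y : G => x * y * x⁻¹) (1 : G)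
  map_one' := ContinuousLinearMap.coe_injective (Ad_eq_id_of_mem_center I (Subgroup.one_mem _))
  map_mul' x y := by
    have hcomp : (fun z : G => x * z * x⁻¹) ∘ (fun z : G => y * z * y⁻¹) =
        fun z : G => x * y * z * (x * y)⁻¹ := by
      ext z; simp [mul_assoc]
    have h := hasMFDerivAt_comp_of_eq (mdifferentiable_conj I x 1).hasMFDerivAt
      (mdifferentiable_conj I y 1).hasMFDerivAt (by simp)
    rw [hcomp] at h
    exact h.mfderiv

lemma toLinearMap_adRep (x : G) : (adRep I x : E →ₗ[ℝ] E) = Ad I x := rfl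

lemma adRep_eq_one_iff {x : G} : adRep I x = 1 ↔ Ad I x = LinearMap.id := by
  rw [← toLinearMap_adRep, ← ContinuousLinearMap.coe_injective.eq_iff]
  rfl

lemma contMDiff_adRep : ContMDiff I 𝓘(ℝ, E →L[ℝ] E) ∞ (adRep I : G → E →L[ℝ] E) := by
  intro x₀
  have hconj : ContMDiff (I.prod I) I ∞ (Function.uncurry fun x y : G => x * y * x⁻¹) :=
    (contMDiff_fst.mul contMDiff_snd).mul contMDiff_fst.inv
  have hcoord : ContMDiffAt I 𝓘(ℝ, E →L[ℝ] E) ∞ (inTangentCoordinates I I (fun _ : G => (1 : G))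
      (fun x : G => x * 1 * x⁻¹) (fun x => (adRep I x : E →L[ℝ] E)) x₀) x₀ :=
    ContMDiffAt.mfderiv (m := ∞) (fun x y : G => x * y * x⁻¹) (fun _ => (1 : G)) (hconj (x₀, 1))
      contMDiffAt_const (by simp)
  refine hcoord.congr_of_eventuallyEq (Filter.Eventually.of_forall fun x => ?_)
  -- Conjugation fixes the identity, so the coordinate changes are trivial on both sides.
  have hfix (x : G) : x * 1 * x⁻¹ = 1 := by simp
  have hchange (v : E) :
      (tangentBundleCore I G).coordChange (achart H 1) (achart H 1) 1 v = v :=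
    (tangentBundleCore I G).coordChange_self (achart H 1) 1 (mem_chart_source H 1) v
  rw [inTangentCoordinates_eq _ _ _ (by simp) (by simp)]
  simp only [hfix]
  ext v
  simp only [ContinuousLinearMap.comp_apply, hchange]

/-- The differential at `x` of the adjoint representation, typed by the model space. -/
def adRepDeriv (x : G) : E →L[ℝ] E →L[ℝ] E :=
  mfderiv I 𝓘(ℝ, E →L[ℝ] E) (adRep I : G → E →L[ℝ] E) x

lemma hasMFDerivAt_adRep (x : G) :
    HasMFDerivAt I 𝓘(ℝ, E →L[ℝ] E) (adRep I : G → E →L[ℝ] E) x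
      (adRepDeriv I x : E →L[ℝ] E →L[ℝ] E) :=
  ((contMDiff_adRep I).mdifferentiable (by simp) x).hasMFDerivAt

variable (G) in
/-- The differential at the identity of the adjoint representation. -/
def adDeriv : E →L[ℝ] E →L[ℝ] E := adRepDeriv I (1 : G)

lemma adRepDeriv_mulLeftDeriv (x : G) (Y : E) :
    adRepDeriv I x (mulLeftDeriv I x Y) = adRep I x * adDeriv I G Y := by
  let L : (E →L[ℝ] E) →L[ℝ] (E →L[ℝ] E) := ContinuousLinearMap.mul ℝ (E →L[ℝ] E) (adRep I x)
  have hcomp : (adRep I : G → E →L[ℝ] E) ∘ (fun y : G => x * y) = L ∘ (adRep I) := by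
    ext1 y; simp [L]
  have hright : HasMFDerivAt I 𝓘(ℝ, E →L[ℝ] E) (L ∘ adRep I) (1 : G)
      (L.comp (adDeriv I G) : E →L[ℝ] E →L[ℝ] E) :=
    (ContinuousLinearMap.hasMFDerivAt L).comp 1 (hasMFDerivAt_adRep I 1)
  have h := hasMFDerivAt_comp_of_eq (hasMFDerivAt_adRep I x) (hasMFDerivAt_mul_left I x) (mul_one x)
  rw [hcomp] at h
  exact DFunLike.congr_fun (hasMFDerivAt_unique h hright) Y

lemma hasDerivAt_adRep_comp {γ : ℝ → G} {t : ℝ} {Y : E}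
    (h : HasMFDerivAt 𝓘(ℝ, ℝ) I γ t
      ((1 : ℝ →L[ℝ] ℝ).smulRight (mulLeftDeriv I (γ t) Y) : ℝ →L[ℝ] E)) :
    HasDerivAt (fun s => adRep I (γ s)) (adRep I (γ t) * adDeriv I G Y) t := by
  have hcomp : HasFDerivAt (fun s => adRep I (γ s))
      ((adRepDeriv I (γ t)).comp ((1 : ℝ →L[ℝ] ℝ).smulRight (mulLeftDeriv I (γ t) Y))) t :=
    ((hasMFDerivAt_adRep I (γ t)).comp t h).hasFDerivAt
  simpa [adRepDeriv_mulLeftDeriv] using hcomp.hasDerivAt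

variable [FiniteDimensional ℝ E]

lemma lyapunov_eq_traceCLM_adRep (x : G) : lyapunov I x = traceCLM E (adRep I x) := rfl

lemma mvfderiv_lyapunov_mulLeftDeriv (x : G) (Y : E) :
    (mvfderiv I (lyapunov I : G → ℝ) x : E →L[ℝ] ℝ) (mulLeftDeriv I x Y) =
      traceCLM E (adRep I x * adDeriv I G Y) := by
  have h : HasMFDerivAt I 𝓘(ℝ, ℝ) (lyapunov I : G → ℝ) x ((traceCLM E).comp
      (adRepDeriv I x : E →L[ℝ] E →L[ℝ] E)) :=
    ((traceCLM E).hasMFDerivAt (x := adRep I x)).comp x (hasMFDerivAt_adRep I x)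
  rw [← adRepDeriv_mulLeftDeriv]
  exact DFunLike.congr_fun h.mfderiv _

lemma auxCoeff_eq_traceCLM {m : ℕ} (X : Fin m → GroupLieAlgebra I G) (xr : ℝ → G) (k : Fin m)
    (t : ℝ) (x : G) : auxCoeff I X xr k t x =
      traceCLM E (adRep I x * adDeriv I G (adRep I (xr t) (X k : E))) :=
  mvfderiv_lyapunov_mulLeftDeriv I x _

end AdjointRepresentation

section BracketFormula

variable {E : Type*} [NormedAddCommGroup E] [NormedSpace ℝ E]
  {H : Type*} [TopologicalSpace H] (I : ModelWithCorners ℝ E H)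

lemma hasMFDerivAt_extChartAt_symm_self [I.Boundaryless] {M : Type*} [TopologicalSpace M]
    [ChartedSpace H M] [IsManifold I 1 M] (x : M) :
    HasMFDerivAt 𝓘(ℝ, E) I (extChartAt I x).symm (extChartAt I x x)
      (ContinuousLinearMap.id ℝ E : E →L[ℝ] E) := by
  have h := (mdifferentiableWithinAt_extChartAt_symm (I := I)
    (mem_extChartAt_target (I := I) x)).hasMFDerivWithinAt
  rw [mfderivWithin_range_extChartAt_symm, I.range_eq_univ] at h
  exact h.hasMFDerivAt Filter.univ_mem

/-- The group law read in the preferred chart at the identity. -/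
def chartMul (G : Type*) [TopologicalSpace G] [ChartedSpace H G] [Group G] (p : E × E) : E :=
  extChartAt I (1 : G) ((extChartAt I (1 : G)).symm p.1 * (extChartAt I (1 : G)).symm p.2)

variable {G : Type*} [TopologicalSpace G] [ChartedSpace H G] [Group G]

lemma chartMul_extChartAt_one_left {v : E} (hv : v ∈ (extChartAt I (1 : G)).target) :
    chartMul I G (extChartAt I (1 : G) 1, v) = v := by
  simp only [chartMul, extChartAt_to_inv, one_mul, (extChartAt I (1 : G)).right_inv hv]

lemma chartMul_extChartAt_one_right {u : E} (hu : u ∈ (extChartAt I (1 : G)).target) :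
    chartMul I G (u, extChartAt I (1 : G) 1) = u := by
  simp only [chartMul, extChartAt_to_inv, mul_one, (extChartAt I (1 : G)).right_inv hu]

/-- The differential at `x` of the preferred chart at the identity, typed by the model space. -/
def chartDeriv (x : G) : E →L[ℝ] E := mfderiv I 𝓘(ℝ, E) (extChartAt I (1 : G)) x

lemma eventually_mem_extChartAt_one_target [I.Boundaryless] :
    ∀ᶠ u in 𝓝 (extChartAt I (1 : G) 1), u ∈ (extChartAt I (1 : G)).target :=
  (isOpen_extChartAt_target (I := I) (1 : G)).mem_nhds (mem_extChartAt_target (I := I) (1 : G))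

variable [LieGroup I ∞ G]

lemma hasMFDerivAt_extChartAt_one {x : G} (hx : x ∈ (extChartAt I (1 : G)).source) :
    HasMFDerivAt I 𝓘(ℝ, E) (extChartAt I (1 : G)) x (chartDeriv I x : E →L[ℝ] E) :=
  (mdifferentiableAt_extChartAt (by simpa using hx)).hasMFDerivAt

lemma chartDeriv_one : chartDeriv I (1 : G) = ContinuousLinearMap.id ℝ E := mfderiv_extChartAt_self

variable [I.Boundaryless]

lemma contDiffAt_chartMul {u v : E} (hu : u ∈ (extChartAt I (1 : G)).target)
    (hv : v ∈ (extChartAt I (1 : G)).target)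
    (huv : (extChartAt I (1 : G)).symm u * (extChartAt I (1 : G)).symm v ∈
      (extChartAt I (1 : G)).source) : ContDiffAt ℝ ∞ (chartMul I G) (u, v) := by
  have hsymm {w : E} (hw : w ∈ (extChartAt I (1 : G)).target) :
      ContMDiffAt 𝓘(ℝ, E) I ∞ (extChartAt I (1 : G)).symm w :=
    (contMDiffOn_extChartAt_symm (I := I) (n := ∞) (1 : G)).contMDiffAt
      ((isOpen_extChartAt_target (I := I) (1 : G)).mem_nhds hw)
  have hsmooth : ContMDiffAt (𝓘(ℝ, E).prod 𝓘(ℝ, E)) 𝓘(ℝ, E) ∞ (chartMul I G) (u, v) :=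
    ContMDiffAt.comp (I' := I) (u, v) (contMDiffAt_extChartAt' (by simpa using huv))
      (((hsymm hu).comp (u, v) contMDiffAt_fst).mul ((hsymm hv).comp (u, v) contMDiffAt_snd))
  rw [← modelWithCornersSelf_prod, chartedSpaceSelf_prod] at hsmooth
  exact hsmooth.contDiffAt

lemma contDiffAt_chartMul_right {u : E} (hu : u ∈ (extChartAt I (1 : G)).target) :
    ContDiffAt ℝ ∞ (chartMul I G) (u, extChartAt I (1 : G) 1) :=
  contDiffAt_chartMul I hu (mem_extChartAt_target (I := I) (1 : G))
    (by simpa using (extChartAt I (1 : G)).map_target hu)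

lemma contDiffAt_chartMul_left {v : E} (hv : v ∈ (extChartAt I (1 : G)).target) :
    ContDiffAt ℝ ∞ (chartMul I G) (extChartAt I (1 : G) 1, v) :=
  contDiffAt_chartMul I (mem_extChartAt_target (I := I) (1 : G)) hv
    (by simpa using (extChartAt I (1 : G)).map_target hv)

lemma contDiffAt_chartMul_one :
    ContDiffAt ℝ ∞ (chartMul I G) (extChartAt I (1 : G) 1, extChartAt I (1 : G) 1) :=
  contDiffAt_chartMul_right I (mem_extChartAt_target (I := I) (1 : G))

lemma fderiv_chartMul_one_inr (Z : E) :
    fderiv ℝ (chartMul I G) (extChartAt I (1 : G) 1, extChartAt I (1 : G) 1) (0, Z) = Z := by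
  have h := ((contDiffAt_chartMul_one I (G := G)).differentiableAt (by simp)).hasFDerivAt.comp
    (extChartAt I (1 : G) 1) (hasFDerivAt_prodMk_right _ _)
  have hid : (chartMul I G ∘ fun v => (extChartAt I (1 : G) 1, v))
      =ᶠ[𝓝 (extChartAt I (1 : G) 1)] id :=
    (eventually_mem_extChartAt_one_target I).mono fun v hv => chartMul_extChartAt_one_left I hv
  exact DFunLike.congr_fun (h.unique ((hasFDerivAt_id _).congr_of_eventuallyEq hid)) Z

lemma fderiv_chartMul_one_inl (Z : E) :
    fderiv ℝ (chartMul I G) (extChartAt I (1 : G) 1, extChartAt I (1 : G) 1) (Z, 0) = Z := by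
  have h := ((contDiffAt_chartMul_one I (G := G)).differentiableAt (by simp)).hasFDerivAt.comp
    (f := fun u => (u, extChartAt I (1 : G) 1)) (extChartAt I (1 : G) 1)
    (hasFDerivAt_prodMk_left _ _)
  have hid : (chartMul I G ∘ fun u => (u, extChartAt I (1 : G) 1))
      =ᶠ[𝓝 (extChartAt I (1 : G) 1)] id :=
    (eventually_mem_extChartAt_one_target I).mono fun u hu => chartMul_extChartAt_one_right I hu
  exact DFunLike.congr_fun (h.unique ((hasFDerivAt_id _).congr_of_eventuallyEq hid)) Z

lemma hasFDerivAt_chartMul_right {u : E} (hu : u ∈ (extChartAt I (1 : G)).target) :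
    HasFDerivAt (fun v => chartMul I G (u, v))
      ((chartDeriv I ((extChartAt I (1 : G)).symm u)).comp
        (mulLeftDeriv I ((extChartAt I (1 : G)).symm u))) (extChartAt I (1 : G) 1) := by
  set x := (extChartAt I (1 : G)).symm u
  have hx : x ∈ (extChartAt I (1 : G)).source := (extChartAt I (1 : G)).map_target hu
  have hmul := hasMFDerivAt_comp_of_eq (hasMFDerivAt_mul_left I x)
    (hasMFDerivAt_extChartAt_symm_self I (1 : G)) (extChartAt_to_inv (1 : G))
  exact (hasMFDerivAt_comp_of_eq (hasMFDerivAt_extChartAt_one I hx) hmul (by simp)).hasFDerivAt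

lemma mpullbackWithin_mulInvariantVectorField {u : E} (hu : u ∈ (extChartAt I (1 : G)).target)
    (X : GroupLieAlgebra I G) :
    (VectorField.mpullbackWithin 𝓘(ℝ, E) I (extChartAt I (1 : G)).symm
      (mulInvariantVectorField X) (Set.range I) u : E) =
      fderiv ℝ (chartMul I G) (u, extChartAt I (1 : G) 1) (0, (X : E)) := by
  have hinv : (VectorField.mpullbackWithin 𝓘(ℝ, E) I (extChartAt I (1 : G)).symm
      (mulInvariantVectorField X) (Set.range I) u : E) =
      chartDeriv I ((extChartAt I (1 : G)).symm u)
        (mulLeftDeriv I ((extChartAt I (1 : G)).symm u) X) :=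
    DFunLike.congr_fun (ContinuousLinearMap.inverse_eq
      (mfderivWithin_extChartAt_symm_comp_mfderiv_extChartAt hu)
      (mfderiv_extChartAt_comp_mfderivWithin_extChartAt_symm hu)) _
  have hpartial := ((contDiffAt_chartMul_right I hu).differentiableAt (by simp)).hasFDerivAt.comp
    (extChartAt I (1 : G) 1) (hasFDerivAt_prodMk_right u (extChartAt I (1 : G) 1))
  rw [hinv]
  exact (DFunLike.congr_fun (hpartial.unique (hasFDerivAt_chartMul_right I hu)) X).symm

lemma hasMFDerivAt_conj_extChartAt_symm (x : G) :
    HasMFDerivAt 𝓘(ℝ, E) I ((fun y : G => x * y * x⁻¹) ∘ (extChartAt I (1 : G)).symm)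
      (extChartAt I (1 : G) 1) (adRep I x : E →L[ℝ] E) :=
  hasMFDerivAt_comp_of_eq (mdifferentiable_conj I x 1).hasMFDerivAt
    (hasMFDerivAt_extChartAt_symm_self I (1 : G)) (extChartAt_to_inv (1 : G))

lemma hasFDerivAt_extChartAt_conj (x : G) :
    HasFDerivAt (fun v => extChartAt I (1 : G) (x * (extChartAt I (1 : G)).symm v * x⁻¹))
      (adRep I x) (extChartAt I (1 : G) 1) := by
  have h := hasMFDerivAt_comp_of_eq
    (hasMFDerivAt_extChartAt_one I (mem_extChartAt_source (I := I) (1 : G)))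
    (hasMFDerivAt_conj_extChartAt_symm I x) (by simp)
  rw [chartDeriv_one] at h
  exact h.hasFDerivAt

lemma eventually_chartMul_eq_chartMul_conj (u : E) :
    ∀ᶠ v in 𝓝 (extChartAt I (1 : G) 1), chartMul I G (u, v) =
      chartMul I G (extChartAt I (1 : G) ((extChartAt I (1 : G)).symm u *
        (extChartAt I (1 : G)).symm v * ((extChartAt I (1 : G)).symm u)⁻¹), u) := by
  set x := (extChartAt I (1 : G)).symm u with hx
  have hsource : ∀ᶠ v in 𝓝 (extChartAt I (1 : G) 1),
      x * (extChartAt I (1 : G)).symm v * x⁻¹ ∈ (extChartAt I (1 : G)).source :=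
    (hasMFDerivAt_conj_extChartAt_symm I x).continuousAt.preimage_mem_nhds
      (by simpa using extChartAt_source_mem_nhds (I := I) (1 : G))
  filter_upwards [hsource] with v hv
  simp only [chartMul, (extChartAt I (1 : G)).left_inv hv, ← hx, inv_mul_cancel_right]

/-- `x y = (x y x⁻¹) x`, differentiated in `y` at the identity. -/
lemma fderiv_chartMul_inr_eq_inl_adRep {u : E} (hu : u ∈ (extChartAt I (1 : G)).target) (Y : E) :
    fderiv ℝ (chartMul I G) (u, extChartAt I (1 : G) 1) (0, Y) =
      fderiv ℝ (chartMul I G) (extChartAt I (1 : G) 1, u)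
        (adRep I ((extChartAt I (1 : G)).symm u) Y, 0) := by
  set x := (extChartAt I (1 : G)).symm u
  have hleft := ((contDiffAt_chartMul_right I hu).differentiableAt (by simp)).hasFDerivAt.comp
    (extChartAt I (1 : G) 1) (hasFDerivAt_prodMk_right u (extChartAt I (1 : G) 1))
  have hmul : HasFDerivAt (chartMul I G) (fderiv ℝ (chartMul I G) (extChartAt I (1 : G) 1, u))
      (extChartAt I (1 : G) (x * (extChartAt I (1 : G)).symm (extChartAt I (1 : G) 1) * x⁻¹),
        u) := by
    rw [extChartAt_to_inv, mul_one, mul_inv_cancel]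
    exact ((contDiffAt_chartMul_left I hu).differentiableAt (by simp)).hasFDerivAt
  have hright := hmul.comp (extChartAt I (1 : G) 1)
    ((hasFDerivAt_extChartAt_conj I x).prodMk (hasFDerivAt_const u (extChartAt I (1 : G) 1)))
  exact DFunLike.congr_fun (hleft.unique
    (hright.congr_of_eventuallyEq (eventually_chartMul_eq_chartMul_conj I u))) Y

lemma hasFDerivAt_adRep_extChartAt_symm :
    HasFDerivAt (fun u => adRep I ((extChartAt I (1 : G)).symm u)) (adDeriv I G)
      (extChartAt I (1 : G) 1) :=
  (hasMFDerivAt_comp_of_eq (hasMFDerivAt_adRep I 1)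
    (hasMFDerivAt_extChartAt_symm_self I (1 : G)) (extChartAt_to_inv (1 : G))).hasFDerivAt

variable (G) in
/-- The second derivative at the identity of the group law read in the preferred chart. -/
def chartMulHessian : E × E →L[ℝ] E × E →L[ℝ] E :=
  fderiv ℝ (fderiv ℝ (chartMul I G)) (extChartAt I (1 : G) 1, extChartAt I (1 : G) 1)

lemma chartMulHessian_comm (p q : E × E) : chartMulHessian I G p q = chartMulHessian I G q p :=
  ((contDiffAt_chartMul_one I).isSymmSndFDerivAt (by simpa using ENat.LEInfty.out)).eq p q

lemma hasFDerivAt_fderiv_chartMul :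
    HasFDerivAt (fderiv ℝ (chartMul I G)) (chartMulHessian I G)
      (extChartAt I (1 : G) 1, extChartAt I (1 : G) 1) :=
  (((contDiffAt_chartMul_one I).fderiv_right (m := 1) (by norm_cast)).differentiableAt
    (by simp)).hasFDerivAt

lemma hasFDerivAt_fderiv_chartMul_inr (Z : E) :
    HasFDerivAt (fun u => fderiv ℝ (chartMul I G) (u, extChartAt I (1 : G) 1) (0, Z))
      ((ContinuousLinearMap.apply ℝ E ((0 : E), Z)).comp
        ((chartMulHessian I G).comp (ContinuousLinearMap.inl ℝ E E))) (extChartAt I (1 : G) 1) :=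
  (ContinuousLinearMap.apply ℝ E ((0 : E), Z)).hasFDerivAt.comp (extChartAt I (1 : G) 1)
    ((hasFDerivAt_fderiv_chartMul I).comp (f := fun u => (u, extChartAt I (1 : G) 1))
      (extChartAt I (1 : G) 1) (hasFDerivAt_prodMk_left _ _))

lemma chartMulHessian_inl_inr (W Z : E) :
    chartMulHessian I G (W, 0) (0, Z) = chartMulHessian I G (0, W) (Z, 0) + adDeriv I G W Z := by
  have hsymm : (fun u => fderiv ℝ (chartMul I G) (u, extChartAt I (1 : G) 1) (0, Z))
      =ᶠ[𝓝 (extChartAt I (1 : G) 1)] fun u => fderiv ℝ (chartMul I G) (extChartAt I (1 : G) 1, u)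
        (adRep I ((extChartAt I (1 : G)).symm u) Z, 0) :=
    (eventually_mem_extChartAt_one_target I).mono fun u hu =>
      fderiv_chartMul_inr_eq_inl_adRep I hu Z
  have hvec := ((ContinuousLinearMap.inl ℝ E E).comp
    (ContinuousLinearMap.apply ℝ E Z)).hasFDerivAt.comp (extChartAt I (1 : G) 1)
      (hasFDerivAt_adRep_extChartAt_symm I (G := G))
  have hright := ((hasFDerivAt_fderiv_chartMul I (G := G)).comp (extChartAt I (1 : G) 1)
    (hasFDerivAt_prodMk_right _ _)).clm_apply hvec
  have h := DFunLike.congr_fun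
    ((hasFDerivAt_fderiv_chartMul_inr I Z).unique (hright.congr_of_eventuallyEq hsymm)) W
  simp only [Function.comp_apply, ContinuousLinearMap.comp_apply, add_apply,
    ContinuousLinearMap.flip_apply, extChartAt_to_inv, map_one, ContinuousLinearMap.inl_apply,
    ContinuousLinearMap.inr_apply, ContinuousLinearMap.apply_apply, one_apply_eq_self,
    fderiv_chartMul_one_inl] at h
  rw [h, add_comm]

lemma lieBracket_fderiv_chartMul (X Y : E) :
    VectorField.lieBracket ℝ
        (fun u => fderiv ℝ (chartMul I G) (u, extChartAt I (1 : G) 1) (0, X))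
        (fun u => fderiv ℝ (chartMul I G) (u, extChartAt I (1 : G) 1) (0, Y))
        (extChartAt I (1 : G) 1) = adDeriv I G X Y := by
  rw [VectorField.lieBracket, (hasFDerivAt_fderiv_chartMul_inr I X).fderiv,
    (hasFDerivAt_fderiv_chartMul_inr I Y).fderiv, fderiv_chartMul_one_inr, fderiv_chartMul_one_inr]
  simp only [ContinuousLinearMap.comp_apply, ContinuousLinearMap.inl_apply,
    ContinuousLinearMap.apply_apply]
  rw [chartMulHessian_inl_inr, chartMulHessian_comm I (0, X), add_sub_cancel_left]

theorem lie_eq_adDeriv (X Y : GroupLieAlgebra I G) :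
    ⁅X, Y⁆ = adDeriv I G (X : E) (Y : E) := by
  let pullback (Z : GroupLieAlgebra I G) : E → E := VectorField.mpullbackWithin 𝓘(ℝ, E) I
    (extChartAt I (1 : G)).symm (mulInvariantVectorField Z) (Set.range I)
  have hpull (Z : GroupLieAlgebra I G) : pullback Z =ᶠ[𝓝 (extChartAt I (1 : G) 1)]
      fun u => fderiv ℝ (chartMul I G) (u, extChartAt I (1 : G) 1) (0, (Z : E)) :=
    (eventually_mem_extChartAt_one_target I).mono fun u hu =>
      mpullbackWithin_mulInvariantVectorField I hu Z
  have huniv : (extChartAt I (1 : G)).symm ⁻¹' Set.univ ∩ Set.range I = Set.univ := by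
    simp [I.range_eq_univ]
  have hchart (s : Set E) (hs : s = Set.univ) : (chartDeriv I (1 : G)).inverse
      (VectorField.lieBracketWithin ℝ (pullback X) (pullback Y) s (extChartAt I (1 : G) 1)) =
        adDeriv I G (X : E) (Y : E) := by
    rw [chartDeriv_one, ContinuousLinearMap.inverse_id, hs, VectorField.lieBracketWithin_univ,
      (hpull X).lieBracket_vectorField_eq (hpull Y), ContinuousLinearMap.id_apply]
    exact lieBracket_fderiv_chartMul I (X : E) (Y : E)
  exact hchart _ huniv

lemma eq_zero_of_adDeriv_eq_zero [CompleteSpace E]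
    (hcenter : LieAlgebra.center ℝ (GroupLieAlgebra I G) = ⊥)
    {X : GroupLieAlgebra I G} (hX : adDeriv I G (X : E) = 0) : X = 0 := by
  have hmem : X ∈ LieAlgebra.center ℝ (GroupLieAlgebra I G) := by
    rw [LieModule.mem_maxTrivSubmodule]
    intro Y
    have hlie : ⁅X, Y⁆ = 0 := (lie_eq_adDeriv I X Y).trans (DFunLike.congr_fun hX (Y : E))
    rw [← lie_skew, hlie, neg_zero]
  rwa [hcenter] at hmem

end BracketFormula

section Trapping

variable {M : Type*} [TopologicalSpace M]

lemma mem_interior_of_forall_notMem_frontier {K : Set M} (hK : IsClosed K) {w : ℝ → M}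
    (hw : Continuous w) {t₀ : ℝ} (h₀ : w t₀ ∈ interior K)
    (hfront : ∀ t, t₀ ≤ t → w t ∉ frontier K) {t : ℝ} (ht : t₀ ≤ t) : w t ∈ interior K := by
  have hsub : w '' Set.Icc t₀ t ⊆ interior K ∪ Kᶜ := by
    rintro _ ⟨s, hs, rfl⟩
    rw [Set.mem_union, Set.mem_compl_iff, or_iff_not_imp_right, not_not]
    intro hsK
    by_contra hint
    exact hfront s hs.1 ⟨subset_closure hsK, hint⟩
  exact (isPreconnected_Icc.image w hw.continuousOn).subset_left_of_subset_union isOpen_interior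
    hK.isOpen_compl (disjoint_compl_right.mono_left interior_subset) hsub
    ⟨w t₀, ⟨t₀, Set.left_mem_Icc.2 ht, rfl⟩, h₀⟩ ⟨t, Set.right_mem_Icc.2 ht, rfl⟩

lemma exists_between_of_forall_frontier_lt {K : Set M} (hK : IsCompact K) (hclosed : IsClosed K)
    {V : M → ℝ} (hV : Continuous V) {a : ℝ} (hlt : ∀ y ∈ frontier K, V y < a) :
    ∃ c < a, ∀ y ∈ frontier K, V y ≤ c := by
  rcases (frontier K).eq_empty_or_nonempty with hempty | hne
  · exact ⟨a - 1, by linarith, by simp [hempty]⟩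
  · obtain ⟨y, hy, hmax⟩ := (hK.of_isClosed_subset isClosed_frontier
      hclosed.frontier_subset).exists_isMaxOn hne hV.continuousOn
    exact ⟨V y, hlt y hy, fun x hx => hmax hx⟩

theorem exists_mem_nhds_forall_monotone_mem {K : Set M} (hK : IsCompact K)
    (hclosed : IsClosed K) {V : M → ℝ} (hV : Continuous V) {z : M} (hz : K ∈ 𝓝 z)
    (hlt : ∀ y ∈ frontier K, V y < V z) :
    ∃ U ∈ 𝓝 z, ∀ w : ℝ → M, Continuous w → Monotone (V ∘ w) →
      ∀ t₀, w t₀ ∈ U → ∀ t, t₀ ≤ t → w t ∈ K := by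
  obtain ⟨c, hcz, hc⟩ := exists_between_of_forall_frontier_lt hK hclosed hV hlt
  refine ⟨interior K ∩ {y | c < V y}, Filter.inter_mem (interior_mem_nhds.2 hz)
    ((isOpen_lt continuous_const hV).mem_nhds hcz), fun w hw hmono t₀ h₀ t ht => ?_⟩
  refine interior_subset (mem_interior_of_forall_notMem_frontier hclosed hw h₀.1 ?_ ht)
  exact fun s hs hfront => ((h₀.2.trans_le (hmono hs)).trans_le (hc _ hfront)).false

end Trapping

section CriticalPoints

/-- The continuous bilinear map `(B, Y) ↦ τ (B * D Y)`. For `τ = tr` and `D = ad` it computes the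
differential of `tr ∘ Ad` along left-invariant vector fields. -/
def mulPairing {F 𝔸 : Type*} [NormedAddCommGroup F] [NormedSpace ℝ F] [NormedRing 𝔸]
    [NormedAlgebra ℝ 𝔸] (τ : 𝔸 →L[ℝ] ℝ) (D : F →L[ℝ] 𝔸) : 𝔸 →L[ℝ] F →L[ℝ] ℝ :=
  ((ContinuousLinearMap.compL ℝ F 𝔸 ℝ).flip D).comp
    ((ContinuousLinearMap.compL ℝ 𝔸 𝔸 ℝ τ).comp (ContinuousLinearMap.mul ℝ 𝔸))

variable {E : Type*} [NormedAddCommGroup E] [NormedSpace ℝ E] [FiniteDimensional ℝ E]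
  {H : Type*} [TopologicalSpace H] (I : ModelWithCorners ℝ E H)
  {G : Type*} [TopologicalSpace G] [ChartedSpace H G] [Group G]

lemma lyapunov_eq_finrank_of_Ad_eq_id {z : G} (hz : Ad I z = LinearMap.id) :
    lyapunov I z = Module.finrank ℝ E := by
  unfold lyapunov
  rw [hz]
  exact LinearMap.trace_id ℝ E

variable [LieGroup I ∞ G]

/-- `y` is a critical point of `tr ∘ Ad`: the derivatives along all left-invariant vector fields
vanish there. -/
def IsLyapunovCritical (y : G) : Prop :=
  mulPairing (traceCLM E) (adDeriv I G) (adRep I y) = 0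

lemma continuous_lyapunov : Continuous (lyapunov I : G → ℝ) :=
  (traceCLM E).continuous.comp (contMDiff_adRep I).continuous

variable [CompactSpace G]

variable (G) in
lemma exists_basis_toMatrix_adRep_mem_orthogonalGroup :
    ∃ b : Module.Basis (Fin (Module.finrank ℝ E)) ℝ E,
      ∀ x : G, LinearMap.toMatrix b b (adRep I x) ∈ Matrix.orthogonalGroup _ ℝ :=
  have : IsTopologicalGroup G := topologicalGroup_of_lieGroup I ∞
  exists_basis_toMatrix_mem_orthogonalGroup (contMDiff_adRep I).continuous

lemma lyapunov_le_finrank (x : G) : lyapunov I x ≤ Module.finrank ℝ E := by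
  obtain ⟨b, hb⟩ := exists_basis_toMatrix_adRep_mem_orthogonalGroup I G
  exact traceCLM_le_finrank_of_toMatrix_mem_orthogonalGroup b (hb x)

variable [I.Boundaryless]

lemma isLyapunovCritical_of_lyapunov_eq_finrank {y : G}
    (hy : lyapunov I y = Module.finrank ℝ E) : IsLyapunovCritical I y := by
  let φ : (E →L[ℝ] E) →L[ℝ] ℝ := (traceCLM E).comp (ContinuousLinearMap.mul ℝ _ (adRep I y))
  have hφ (x : G) : φ (adRep I x) = lyapunov I (y * x) := by
    rw [lyapunov_eq_traceCLM_adRep, map_mul]; rfl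
  have hmax : IsLocalMax (fun u => φ (adRep I ((extChartAt I (1 : G)).symm u)))
      (extChartAt I (1 : G) 1) := Filter.Eventually.of_forall fun u => by
    simp only [hφ, extChartAt_to_inv, mul_one, hy]
    exact lyapunov_le_finrank I _
  exact hmax.hasFDerivAt_eq_zero
    (φ.hasFDerivAt.comp (extChartAt I (1 : G) 1) (hasFDerivAt_adRep_extChartAt_symm I))

lemma adDeriv_eq_zero_of_traceCLM_mul_self_eq_zero {X : E}
    (hX : traceCLM E (adDeriv I G X * adDeriv I G X) = 0) : adDeriv I G X = 0 := by
  obtain ⟨b, hb⟩ := exists_basis_toMatrix_adRep_mem_orthogonalGroup I G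
  refine eq_zero_of_toMatrix_transpose_eq_neg_of_traceCLM_mul_self_eq_zero b ?_ hX
  exact toMatrix_transpose_eq_neg_of_hasFDerivAt b (Filter.Eventually.of_forall fun u => hb _)
    (by rw [extChartAt_to_inv, map_one]) (hasFDerivAt_adRep_extChartAt_symm I) X

lemma ker_mulPairing_comp_adDeriv (hcenter : LieAlgebra.center ℝ (GroupLieAlgebra I G) = ⊥) :
    LinearMap.ker ((mulPairing (traceCLM E) (adDeriv I G)).comp (adDeriv I G) :
      E →ₗ[ℝ] E →L[ℝ] ℝ) = ⊥ := by
  have := FiniteDimensional.complete ℝ E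
  rw [LinearMap.ker_eq_bot']
  intro X hX
  exact eq_zero_of_adDeriv_eq_zero I hcenter (X := X)
    (adDeriv_eq_zero_of_traceCLM_mul_self_eq_zero I (DFunLike.congr_fun hX X))

/-- The Hessian of `tr ∘ Ad` at the identity is the Killing form, which is definite. -/
lemma eventually_eq_one_of_isLyapunovCritical
    (hcenter : LieAlgebra.center ℝ (GroupLieAlgebra I G) = ⊥) :
    ∀ᶠ y in 𝓝 (1 : G), IsLyapunovCritical I y → y = 1 := by
  obtain ⟨C, -, hC⟩ := LinearMap.exists_antilipschitzWith _
    (ker_mulPairing_comp_adDeriv I hcenter)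
  have hderiv := (mulPairing (traceCLM E) (adDeriv I G)).hasFDerivAt.comp (extChartAt I (1 : G) 1)
    (hasFDerivAt_adRep_extChartAt_symm I)
  have hne := eventually_nhdsWithin_iff.1 (hderiv.eventually_ne (c := 0) ⟨C, hC⟩)
  filter_upwards [(continuousAt_extChartAt (I := I) (1 : G)).eventually hne,
    extChartAt_source_mem_nhds (I := I) (1 : G)] with y hy hsource hcrit
  by_contra hy1
  refine hy (fun heq => hy1 ((extChartAt I (1 : G)).injOn hsource
    (mem_extChartAt_source (I := I) (1 : G)) heq)) ?_
  rw [Function.comp_apply, (extChartAt I (1 : G)).left_inv hsource]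
  exact hcrit

lemma eventually_eq_of_isLyapunovCritical
    (hcenter : LieAlgebra.center ℝ (GroupLieAlgebra I G) = ⊥) {z : G}
    (hz : Ad I z = LinearMap.id) : ∀ᶠ y in 𝓝 z, IsLyapunovCritical I y → y = z := by
  have : IsTopologicalGroup G := topologicalGroup_of_lieGroup I ∞
  have hshift : Filter.Tendsto (fun y : G => z⁻¹ * y) (𝓝 z) (𝓝 1) := by
    simpa using (continuous_const_mul z⁻¹).tendsto z
  have hrep (y : G) : adRep I (z⁻¹ * y) = adRep I y := by
    calc adRep I (z⁻¹ * y) = adRep I z * adRep I (z⁻¹ * y) := by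
          rw [(adRep_eq_one_iff I).2 hz, one_mul]
      _ = adRep I y := by rw [← map_mul, mul_inv_cancel_left]
  filter_upwards [hshift.eventually (eventually_eq_one_of_isLyapunovCritical I hcenter)]
    with y hy hcrit
  exact (inv_mul_eq_one.1 (hy (by rwa [IsLyapunovCritical, hrep]))).symm

theorem exists_isCompact_trapping [T2Space G]
    (hcenter : LieAlgebra.center ℝ (GroupLieAlgebra I G) = ⊥) {z : G}
    (hz : Ad I z = LinearMap.id) :
    ∃ K : Set G, IsCompact K ∧ (∀ y ∈ K, IsLyapunovCritical I y → y = z) ∧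
      ∃ U ∈ 𝓝 z, ∀ w : ℝ → G, Continuous w → Monotone (lyapunov I ∘ w) →
        ∀ t₀, w t₀ ∈ U → ∀ t, t₀ ≤ t → w t ∈ K := by
  obtain ⟨K, hKz, hclosed, hK⟩ := exists_mem_nhds_isClosed_subset
    (eventually_eq_of_isLyapunovCritical I hcenter hz)
  refine ⟨K, hclosed.isCompact, hK, exists_mem_nhds_forall_monotone_mem hclosed.isCompact
    hclosed (continuous_lyapunov I) hKz fun y hy => ?_⟩
  rw [lyapunov_eq_finrank_of_Ad_eq_id I hz]
  refine lt_of_le_of_ne (lyapunov_le_finrank I y) fun hmax => hy.2 ?_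
  rw [hK (hclosed.frontier_subset hy) (isLyapunovCritical_of_lyapunov_eq_finrank I hmax)]
  exact mem_interior_iff_mem_nhds.2 hKz

end CriticalPoints

section Analysis

open Filter

/-- **Barbalat's lemma**. -/
lemma tendsto_zero_of_hasDerivAt_of_uniformContinuous {v f : ℝ → ℝ} {c : ℝ}
    (hv : ∀ t, HasDerivAt v (f t) t) (hf : ∀ t, 0 ≤ f t) (huc : UniformContinuous f)
    (hc : ∀ t, v t ≤ c) : Tendsto f atTop (𝓝 0) := by
  have hlim : Tendsto v atTop (𝓝 (⨆ t, v t)) :=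
    tendsto_atTop_ciSup (monotone_of_hasDerivAt_nonneg hv hf) ⟨c, Set.forall_mem_range.2 hc⟩
  rw [Metric.tendsto_atTop]
  intro ε hε
  obtain ⟨δ, hδ, hfδ⟩ := Metric.uniformContinuous_iff.1 huc (ε / 2) (by positivity)
  have hincr : Tendsto (fun t => v (t + δ / 2) - v t) atTop (𝓝 0) := by
    simpa using (hlim.comp (tendsto_atTop_add_const_right _ (δ / 2) tendsto_id)).sub hlim
  obtain ⟨N, hN⟩ := (hincr.eventually_lt_const (show 0 < ε / 2 * (δ / 2) by positivity))
    |>.exists_forall_of_atTop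
  refine ⟨N, fun t ht => ?_⟩
  obtain ⟨s, hs, hslope⟩ := exists_hasDerivAt_eq_slope v f (show t < t + δ / 2 by linarith)
    (fun x _ => (hv x).continuousAt.continuousWithinAt) fun x _ => hv x
  have hfs : f s < ε / 2 := by
    rw [hslope, add_sub_cancel_left, div_lt_iff₀ (by positivity)]
    exact hN t ht
  have hclose : dist (f s) (f t) < ε / 2 := hfδ (by
    rw [Real.dist_eq, abs_lt]; constructor <;> linarith [hs.1, hs.2])
  rw [Real.dist_eq, abs_lt] at hclose
  rw [Real.dist_eq, sub_zero, abs_of_nonneg (hf t)]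
  linarith

lemma uniformContinuous_of_periodic {α : Type*} [UniformSpace α] {f : ℝ → α} {T : ℝ}
    (hT : 0 < T) (hp : Function.Periodic f T) (hf : Continuous f) : UniformContinuous f := by
  have : Fact (0 < T) := ⟨hT⟩
  have hlift : Continuous (hp.lift : AddCircle T → α) := continuous_quot_lift _ hf
  have hmk : UniformContinuous (fun x : ℝ => (x : AddCircle T)) :=
    uniformContinuous_addMonoidHom_of_continuous
      (f := QuotientAddGroup.mk' (AddSubgroup.zmultiples T)) (AddCircle.continuous_mk' T)
  exact (CompactSpace.uniformContinuous_of_continuous hlift).comp hmk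

lemma uniformContinuous_comp_of_forall_mem_isCompact {α β γ : Type*} [UniformSpace α]
    [UniformSpace β] [UniformSpace γ] {q : α → β} (hq : UniformContinuous q) {K : Set β}
    (hK : IsCompact K) (hqK : ∀ t, q t ∈ K) {Ψ : β → γ} (hΨ : Continuous Ψ) :
    UniformContinuous fun t => Ψ (q t) :=
  uniformContinuousOn_univ.1 ((hK.uniformContinuousOn_of_continuous hΨ.continuousOn).comp
    (uniformContinuousOn_univ.2 hq) fun t _ => hqK t)

variable {F : Type*} [NormedAddCommGroup F] [NormedSpace ℝ F]

lemma contDiff_infty_of_hasDerivAt {A A' : ℝ → F} (hA : ∀ t, HasDerivAt A (A' t) t)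
    (hboot : ∀ n : ℕ, ContDiff ℝ n A → ContDiff ℝ n A') : ContDiff ℝ ∞ A := by
  rw [contDiff_infty]
  intro n
  induction n with
  | zero => exact contDiff_zero.2 (continuous_iff_continuousAt.2 fun t => (hA t).continuousAt)
  | succ n ih =>
    refine (contDiff_succ_iff_deriv (n := n)).2 ⟨fun t => (hA t).differentiableAt, by simp, ?_⟩
    rw [show deriv A = A' from funext fun t => (hA t).deriv]
    exact hboot n ih

lemma tendsto_sub_zero_of_hasDerivAt_tendsto_zero {B B' : ℝ → F}
    (hB : ∀ t, HasDerivAt B (B' t) t) (hB' : Tendsto B' atTop (𝓝 0)) {s : ℝ → ℝ} {T : ℝ}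
    (hs : ∀ t, t ≤ s t ∧ s t ≤ t + T) : Tendsto (fun t => B (s t) - B t) atTop (𝓝 0) := by
  have hT : 0 ≤ T := by linarith [(hs 0).1, (hs 0).2]
  rw [Metric.tendsto_atTop] at hB' ⊢
  intro ε hε
  obtain ⟨N, hN⟩ := hB' (ε / (T + 1)) (by positivity)
  refine ⟨N, fun t ht => ?_⟩
  have hmvt : ‖B (s t) - B t‖ ≤ ε / (T + 1) * ‖s t - t‖ :=
    (convex_Ici t).norm_image_sub_le_of_norm_hasDerivWithin_le
      (fun x _ => (hB x).hasDerivWithinAt)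
      (fun x hx => (mem_ball_zero_iff.1 (hN x (ht.le.trans hx))).le) (Set.mem_Ici.2 le_rfl)
      (hs t).1
  rw [dist_zero_right]
  refine hmvt.trans_lt ?_
  rw [Real.norm_of_nonneg (by linarith [(hs t).1]), div_mul_eq_mul_div,
    div_lt_iff₀ (by positivity)]
  nlinarith [(hs t).2]

end Analysis

section Feedback

open Filter

variable {ι F 𝔸 : Type*} [Fintype ι] [NormedAddCommGroup F] [NormedSpace ℝ F]

/-- The vector `∑ k, c B (Y k) • Y k`: the projection of the gradient `c B` on the available
directions `Y k`. For `c = mulPairing (tr) (ad)` and `Y k = Ad (xr t) Xₖ` it is the auxiliary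
field, translated back to the identity. -/
def feedback [NormedAddCommGroup 𝔸] [NormedSpace ℝ 𝔸] (c : 𝔸 →L[ℝ] F →L[ℝ] ℝ) (Y : ι → F)
    (B : 𝔸) : F :=
  ∑ k, c B (Y k) • Y k

lemma apply_feedback [NormedAddCommGroup 𝔸] [NormedSpace ℝ 𝔸] (c : 𝔸 →L[ℝ] F →L[ℝ] ℝ)
    (Y : ι → F) (B : 𝔸) : c B (feedback c Y B) = ∑ k, c B (Y k) ^ 2 := by
  simp only [feedback, map_sum, map_smul, smul_eq_mul, sq]

lemma contDiff_feedback [NormedAddCommGroup 𝔸] [NormedSpace ℝ 𝔸] (c : 𝔸 →L[ℝ] F →L[ℝ] ℝ)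
    {n : ℕ∞ω} : ContDiff ℝ n fun p : (ι → F) × 𝔸 => feedback c p.1 p.2 := by
  have hdir (k : ι) : ContDiff ℝ n fun p : (ι → F) × 𝔸 => p.1 k :=
    (contDiff_apply ℝ F k).comp contDiff_fst
  exact ContDiff.sum fun k _ =>
    ((c.contDiff.comp contDiff_snd).clm_apply (hdir k)).smul (hdir k)

variable [NormedRing 𝔸] [NormedAlgebra ℝ 𝔸] {τ : 𝔸 →L[ℝ] ℝ} {D : F →L[ℝ] 𝔸}
  {B : ℝ → 𝔸} {Y : ℝ → ι → F}

lemma hasDerivAt_of_hasDerivAt_mul_feedback {t : ℝ}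
    (hB : HasDerivAt B (B t * D (feedback (mulPairing τ D) (Y t) (B t))) t) :
    HasDerivAt (fun s => τ (B s)) (∑ k, mulPairing τ D (B t) (Y t k) ^ 2) t := by
  rw [← apply_feedback]
  exact τ.hasFDerivAt.comp_hasDerivAt t hB

variable (hB : ∀ t, HasDerivAt B (B t * D (feedback (mulPairing τ D) (Y t) (B t))) t)

include hB

lemma monotone_of_hasDerivAt_mul_feedback : Monotone fun t => τ (B t) :=
  monotone_of_hasDerivAt_nonneg (fun t => hasDerivAt_of_hasDerivAt_mul_feedback (hB t))
    fun _ => Finset.sum_nonneg fun _ _ => sq_nonneg _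

variable {K : Set 𝔸} (hK : IsCompact K) (hBK : ∀ t, B t ∈ K)
  {L : Set (ι → F)} (hL : IsCompact L) (hYL : ∀ t, Y t ∈ L)

include hK hBK hL hYL

lemma uniformContinuous_of_hasDerivAt_mul_feedback : UniformContinuous B := by
  have hcont : Continuous fun p : (ι → F) × 𝔸 =>
      p.2 * D (feedback (mulPairing τ D) p.1 p.2) :=
    continuous_snd.mul (D.continuous.comp (contDiff_feedback (n := 0) _).continuous)
  obtain ⟨C, hC⟩ := ((hL.prod hK).image hcont).isBounded.subset_closedBall 0
  have hlip : LipschitzWith C.toNNReal B :=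
    lipschitzWith_of_nnnorm_deriv_le (fun t => (hB t).differentiableAt) fun t => by
      rw [(hB t).deriv, ← NNReal.coe_le_coe, coe_nnnorm]
      exact (mem_closedBall_zero_iff.1 (hC ⟨(Y t, B t), ⟨hYL t, hBK t⟩, rfl⟩)).trans
        (Real.le_coe_toNNReal C)
  exact hlip.uniformContinuous

variable (hY : UniformContinuous Y)

include hY

lemma tendsto_mulPairing_zero (k : ι) :
    Tendsto (fun t => mulPairing τ D (B t) (Y t k)) atTop (𝓝 0) := by
  have hcont : Continuous fun p : (ι → F) × 𝔸 => ∑ k, mulPairing τ D p.2 (p.1 k) ^ 2 :=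
    continuous_finsetSum _ fun k _ => (((mulPairing τ D).continuous.comp continuous_snd).clm_apply
      ((continuous_apply k).comp continuous_fst)).pow 2
  have hpair : UniformContinuous fun t => (Y t, B t) :=
    hY.prodMk (uniformContinuous_of_hasDerivAt_mul_feedback hB hK hBK hL hYL)
  have huc : UniformContinuous fun t => ∑ k, mulPairing τ D (B t) (Y t k) ^ 2 :=
    uniformContinuous_comp_of_forall_mem_isCompact hpair (hL.prod hK)
      (fun t => ⟨hYL t, hBK t⟩) hcont
  obtain ⟨c, hc⟩ := (hK.image τ.continuous).bddAbove
  have hsum : Tendsto (fun t => ∑ k, mulPairing τ D (B t) (Y t k) ^ 2) atTop (𝓝 0) :=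
    tendsto_zero_of_hasDerivAt_of_uniformContinuous (v := fun t => τ (B t))
      (fun t => hasDerivAt_of_hasDerivAt_mul_feedback (hB t))
      (fun t => Finset.sum_nonneg fun k _ => sq_nonneg _) huc
      fun t => hc ⟨B t, hBK t, rfl⟩
  have hsq : Tendsto (fun t => mulPairing τ D (B t) (Y t k) ^ 2) atTop (𝓝 0) :=
    squeeze_zero (fun t => sq_nonneg _) (fun t => Finset.single_le_sum
      (f := fun k => mulPairing τ D (B t) (Y t k) ^ 2) (fun k _ => sq_nonneg _)
      (Finset.mem_univ k)) hsum
  refine (tendsto_zero_iff_abs_tendsto_zero _).2 ?_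
  simpa [Real.sqrt_sq_eq_abs, Function.comp_def] using hsq.sqrt

lemma tendsto_mul_feedback_zero :
    Tendsto (fun t => B t * D (feedback (mulPairing τ D) (Y t) (B t))) atTop (𝓝 0) := by
  obtain ⟨r, hr⟩ := hL.isBounded.subset_closedBall 0
  obtain ⟨R, hR⟩ := hK.isBounded.subset_closedBall 0
  have hterm (k : ι) : Tendsto (fun t => mulPairing τ D (B t) (Y t k) • Y t k) atTop (𝓝 0) :=
    NormedField.tendsto_zero_smul_of_tendsto_zero_of_bounded
      (tendsto_mulPairing_zero hB hK hBK hL hYL hY k)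
      (isBoundedUnder_of ⟨r, fun t =>
        (norm_le_pi_norm _ k).trans (mem_closedBall_zero_iff.1 (hr (hYL t)))⟩)
  have hfeedback : Tendsto (fun t => feedback (mulPairing τ D) (Y t) (B t)) atTop (𝓝 0) := by
    simpa [feedback] using tendsto_finsetSum Finset.univ fun k _ => hterm k
  have hD : Tendsto (fun t => D (feedback (mulPairing τ D) (Y t) (B t))) atTop (𝓝 0) := by
    simpa [Function.comp_def] using (D.continuous.tendsto 0).comp hfeedback
  exact isBoundedUnder_le_mul_tendsto_zero
    (isBoundedUnder_of ⟨R, fun t => mem_closedBall_zero_iff.1 (hR (hBK t))⟩) hD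

omit hL hYL hY

variable {T : ℝ} (hT : 0 < T) (hYp : Function.Periodic Y T) (hYc : Continuous Y)

include hT hYp hYc

/-- Since `B' → 0`, the values of `B` at `t` and at the next time congruent to `σ` modulo `T` get
close, and at the latter the direction available is `Y σ k`. -/
lemma tendsto_mulPairing_zero_of_periodic (σ : ℝ) (k : ι) :
    Tendsto (fun t => mulPairing τ D (B t) (Y σ k)) atTop (𝓝 0) := by
  have hL : IsCompact (Set.range Y) := hYp.compact_of_continuous hT.ne' hYc
  have hY : UniformContinuous Y := uniformContinuous_of_periodic hT hYp hYc
  let s : ℝ → ℝ := fun t => toIcoMod hT t σ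
  have hs (t) : t ≤ s t ∧ s t ≤ t + T :=
    ⟨left_le_toIcoMod hT t σ, (toIcoMod_lt_right hT t σ).le⟩
  have hYs (t) : Y (s t) = Y σ := hYp.sub_zsmul_eq _
  have hdiff : Tendsto (fun t => mulPairing τ D (B (s t) - B t) (Y σ k)) atTop (𝓝 0) := by
    have hcont : Continuous fun A => mulPairing τ D A (Y σ k) := by fun_prop
    simpa [Function.comp_def] using (hcont.tendsto 0).comp
      (tendsto_sub_zero_of_hasDerivAt_tendsto_zero hB
        (tendsto_mul_feedback_zero hB hK hBK hL (fun t => ⟨t, rfl⟩) hY) hs)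
  have hnext : Tendsto (fun t => mulPairing τ D (B (s t)) (Y σ k)) atTop (𝓝 0) := by
    have h := (tendsto_mulPairing_zero hB hK hBK hL (fun t => ⟨t, rfl⟩) hY k).comp
      (tendsto_atTop_mono (fun t => (hs t).1) tendsto_id : Tendsto s atTop atTop)
    simpa only [Function.comp_def, hYs] using h
  simpa using hnext.sub hdiff

theorem tendsto_mulPairing_zero_of_mem_span {Z : F}
    (hZ : Z ∈ Submodule.span ℝ {v : F | ∃ (t : ℝ) (k : ι), v = Y t k}) :
    Tendsto (fun t => mulPairing τ D (B t) Z) atTop (𝓝 0) := by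
  induction hZ using Submodule.span_induction with
  | mem Z hZ =>
    obtain ⟨σ, k, rfl⟩ := hZ
    exact tendsto_mulPairing_zero_of_periodic hB hK hBK hT hYp hYc σ k
  | zero => simp
  | add x y _ _ hx hy => simpa using hx.add hy
  | smul a x _ hx => simpa using hx.const_mul a

end Feedback

section LocalFlow

open Set VectorField

variable {E : Type*} [NormedAddCommGroup E] [NormedSpace ℝ E] [CompleteSpace E]

lemma exists_nhds_forall_exists_hasDerivAt_mem {f : E → E} {x₀ : E} (hf : ContDiffAt ℝ 1 f x₀)
    {s : Set E} (hs : s ∈ 𝓝 x₀) :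
    ∃ u ∈ 𝓝 x₀, ∃ ε > (0 : ℝ), ∀ x ∈ u, ∃ α : ℝ → E, α 0 = x ∧
      ∀ t ∈ Ioo (-ε) ε, HasDerivAt α (f (α t)) t ∧ α t ∈ s := by
  obtain ⟨ε, hε, a, r, L, K, hr, hpl⟩ := IsPicardLindelof.of_contDiffAt_one hf
  obtain ⟨α, hα, hcont⟩ := (hpl 0).exists_forall_mem_closedBall_eq_hasDerivWithinAt_continuousOn
  simp only [zero_sub, zero_add] at hα hcont
  have hball : Metric.closedBall x₀ (r : ℝ) ∈ 𝓝 x₀ := Metric.closedBall_mem_nhds x₀ hr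
  have hIcc : Icc (-ε) ε ∈ 𝓝 (0 : ℝ) := Icc_mem_nhds (neg_lt_zero.2 hε) hε
  have hαs : ∀ᶠ p in 𝓝 (x₀, (0 : ℝ)), α p ∈ s :=
    (hcont.continuousAt (prod_mem_nhds hball hIcc)).preimage_mem_nhds
      (by rwa [(hα x₀ (mem_of_mem_nhds hball)).1])
  obtain ⟨u, hu, v, hv, huv⟩ := mem_nhds_prod_iff.1 hαs
  obtain ⟨δ, hδ, hδv⟩ := Metric.mem_nhds_iff.1
    (Filter.inter_mem hv (Ioo_mem_nhds (neg_lt_zero.2 hε) hε))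
  simp only [Real.ball_eq_Ioo, zero_sub, zero_add] at hδv
  refine ⟨u ∩ Metric.closedBall x₀ r, Filter.inter_mem hu hball, δ, hδ,
    fun x hx => ⟨fun t => α (x, t), (hα x hx.2).1, fun t ht => ⟨?_, huv ⟨hx.1, (hδv ht).1⟩⟩⟩⟩
  have htε := (hδv ht).2
  exact ((hα x hx.2).2 t (Ioo_subset_Icc_self htε)).hasDerivAt (Icc_mem_nhds htε.1 htε.2)

variable {H : Type*} [TopologicalSpace H] {I : ModelWithCorners ℝ E H} [I.Boundaryless]
  {M : Type*} [TopologicalSpace M] [ChartedSpace H M] {V : (x : M) → TangentSpace I x} {x₀ : M}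

omit [CompleteSpace E] in
lemma hasMFDerivAt_extChartAt_symm_comp [IsManifold I 1 M] {f : ℝ → E} {t : ℝ}
    (hf : HasDerivAt f (mpullbackWithin 𝓘(ℝ, E) I (extChartAt I x₀).symm V (range I) (f t)) t)
    (ht : f t ∈ (extChartAt I x₀).target) :
    HasMFDerivAt 𝓘(ℝ, ℝ) I ((extChartAt I x₀).symm ∘ f) t
      ((1 : ℝ →L[ℝ] ℝ).smulRight (V ((extChartAt I x₀).symm (f t)))) := by
  let L : E →L[ℝ] E := mfderivWithin 𝓘(ℝ, E) I (extChartAt I x₀).symm (range I) (f t)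
  let v : E := V ((extChartAt I x₀).symm (f t))
  have hL : HasMFDerivAt 𝓘(ℝ, E) I (extChartAt I x₀).symm (f t) L := by
    have h := (mdifferentiableWithinAt_extChartAt_symm ht).hasMFDerivWithinAt
    exact h.hasMFDerivAt (by simp [I.range_eq_univ])
  have hinv : L.IsInvertible := isInvertible_mfderivWithin_extChartAt_symm ht
  refine (hL.comp t hf.hasFDerivAt.hasMFDerivAt).congr_mfderiv ?_
  change L.comp ((1 : ℝ →L[ℝ] ℝ).smulRight (L.inverse v)) = (1 : ℝ →L[ℝ] ℝ).smulRight v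
  ext
  simp [hinv.self_apply_inverse]

lemma exists_nhds_forall_exists_isMIntegralCurveOn [IsManifold I 2 M]
    (hV : ContMDiffAt I I.tangent 1 (fun x => (⟨x, V x⟩ : TangentBundle I M)) x₀) :
    ∃ u ∈ 𝓝 x₀, ∃ ε > (0 : ℝ), ∀ x ∈ u, ∃ γ : ℝ → M, γ 0 = x ∧
      IsMIntegralCurveOn γ V (Ioo (-ε) ε) := by
  have : IsManifold I 1 M := .of_le one_le_two
  have hf : ContDiffAt ℝ 1
      (fun u : E => (mpullbackWithin 𝓘(ℝ, E) I (extChartAt I x₀).symm V (range I) u : E))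
      (extChartAt I x₀ x₀) := by
    have h := contMDiffWithinAt_mpullbackWithin_extChartAt_symm (n := 2) (m := 1)
      hV.contMDiffWithinAt uniqueMDiffOn_univ (mem_univ x₀) (by norm_num)
    rw [preimage_univ, inter_univ] at h
    exact contMDiffAt_vectorSpace_iff_contDiffAt.1 (h.contMDiffAt (extChartAt_target_mem_nhds x₀))
  obtain ⟨u, hu, ε, hε, hflow⟩ :=
    exists_nhds_forall_exists_hasDerivAt_mem hf (extChartAt_target_mem_nhds x₀)
  refine ⟨extChartAt I x₀ ⁻¹' u ∩ (extChartAt I x₀).source, Filter.inter_mem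
    ((continuousAt_extChartAt x₀).preimage_mem_nhds hu) (extChartAt_source_mem_nhds x₀), ε, hε,
    fun x hx => ?_⟩
  obtain ⟨f, hf0, hf⟩ := hflow _ hx.1
  exact ⟨(extChartAt I x₀).symm ∘ f,
    by simp only [Function.comp_apply, hf0, (extChartAt I x₀).left_inv hx.2],
    fun t ht => (hasMFDerivAt_extChartAt_symm_comp (hf t ht).1 (hf t ht).2).hasMFDerivWithinAt⟩

lemma exists_pos_forall_mem_exists_isMIntegralCurveOn [IsManifold I 2 M]
    (hV : ContMDiff I I.tangent 1 (fun x => (⟨x, V x⟩ : TangentBundle I M))) {K : Set M}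
    (hK : IsCompact K) :
    ∃ ε > (0 : ℝ), ∀ x ∈ K, ∃ γ : ℝ → M, γ 0 = x ∧ IsMIntegralCurveOn γ V (Ioo (-ε) ε) := by
  choose u hu ε hε hflow using fun x => exists_nhds_forall_exists_isMIntegralCurveOn (hV x)
  obtain ⟨s, -, hs⟩ := hK.elim_nhds_subcover u fun x _ => hu x
  have hlt : ∀ᶠ δ in 𝓝[>] (0 : ℝ), ∀ x ∈ s, δ ≤ ε x :=
    s.eventually_all.2 fun x _ =>
      eventually_nhdsWithin_of_eventually_nhds (eventually_le_nhds (hε x))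
  obtain ⟨δ, hδs, hδ⟩ := (hlt.and self_mem_nhdsWithin).exists
  refine ⟨δ, hδ, fun x hx => ?_⟩
  obtain ⟨y, hy, hxy⟩ := mem_iUnion₂.1 (hs hx)
  obtain ⟨γ, hγ0, hγ⟩ := hflow y x hxy
  exact ⟨γ, hγ0, hγ.mono (Ioo_subset_Ioo (neg_le_neg (hδs y hy)) (hδs y hy))⟩

end LocalFlow

section Suspension

open Set VectorField

variable {E : Type*} [NormedAddCommGroup E] [NormedSpace ℝ E]
  {H : Type*} [TopologicalSpace H] (I : ModelWithCorners ℝ E H)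
  {G : Type*} [TopologicalSpace G] [ChartedSpace H G]

/-- The autonomous vector field `(1, Y)` on `ℝ × G` whose integral curves are the graphs of those of
the time-dependent field `Y`, up to a shift of time. -/
def suspension (Y : ℝ → (x : G) → TangentSpace I x) (p : ℝ × G) :
    TangentSpace (𝓘(ℝ, ℝ).prod I) p :=
  ((1 : ℝ), (Y p.1 p.2 : E))

variable {I} {Y : ℝ → (x : G) → TangentSpace I x} {γ : ℝ → ℝ × G} {s : Set ℝ} {t : ℝ}

lemma hasMFDerivWithinAt_suspension {θ : ℝ → ℝ} {w : ℝ → G} (hθ : HasDerivWithinAt θ 1 s t)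
    (hw : HasMFDerivWithinAt 𝓘(ℝ, ℝ) I w s t
      ((1 : ℝ →L[ℝ] ℝ).smulRight (Y (θ t) (w t) : E) : ℝ →L[ℝ] E)) :
    HasMFDerivWithinAt 𝓘(ℝ, ℝ) (𝓘(ℝ, ℝ).prod I) (fun t => (θ t, w t)) s t
      ((1 : ℝ →L[ℝ] ℝ).smulRight (suspension I Y (θ t, w t) : ℝ × E) : ℝ →L[ℝ] ℝ × E) := by
  refine (hθ.hasFDerivWithinAt.hasMFDerivWithinAt.prodMk hw).congr_mfderiv ?_
  let v : E := Y (θ t) (w t)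
  change (ContinuousLinearMap.toSpanSingleton ℝ (1 : ℝ)).prod ((1 : ℝ →L[ℝ] ℝ).smulRight v) =
    (1 : ℝ →L[ℝ] ℝ).smulRight ((1 : ℝ), v)
  ext <;> simp

lemma hasDerivWithinAt_fst_of_suspension
    (h : HasMFDerivWithinAt 𝓘(ℝ, ℝ) (𝓘(ℝ, ℝ).prod I) γ s t
      ((1 : ℝ →L[ℝ] ℝ).smulRight (suspension I Y (γ t) : ℝ × E) : ℝ →L[ℝ] ℝ × E)) :
    HasDerivWithinAt (fun t => (γ t).1) 1 s t := by
  have hfst : HasFDerivWithinAt (fun t => (γ t).1) ((ContinuousLinearMap.fst ℝ ℝ E).comp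
      ((1 : ℝ →L[ℝ] ℝ).smulRight (suspension I Y (γ t) : ℝ × E))) s t :=
    ((hasMFDerivAt_fst (γ t)).comp_hasMFDerivWithinAt t h).hasFDerivWithinAt
  simpa [suspension] using hfst.hasDerivWithinAt

lemma hasMFDerivWithinAt_snd_of_suspension
    (h : HasMFDerivWithinAt 𝓘(ℝ, ℝ) (𝓘(ℝ, ℝ).prod I) γ s t
      ((1 : ℝ →L[ℝ] ℝ).smulRight (suspension I Y (γ t) : ℝ × E) : ℝ →L[ℝ] ℝ × E)) :
    HasMFDerivWithinAt 𝓘(ℝ, ℝ) I (fun t => (γ t).2) s t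
      ((1 : ℝ →L[ℝ] ℝ).smulRight (Y (γ t).1 (γ t).2 : E) : ℝ →L[ℝ] E) := by
  refine ((hasMFDerivAt_snd (γ t)).comp_hasMFDerivWithinAt t h).congr_mfderiv ?_
  let v : E := Y (γ t).1 (γ t).2
  change (ContinuousLinearMap.snd ℝ ℝ E).comp ((1 : ℝ →L[ℝ] ℝ).smulRight ((1 : ℝ), v)) =
    (1 : ℝ →L[ℝ] ℝ).smulRight v
  ext
  simp

lemma fst_eq_add_of_isMIntegralCurve_suspension (hγ : IsMIntegralCurve γ (suspension I Y))
    (t : ℝ) : (γ t).1 = (γ 0).1 + t := by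
  have hderiv (t : ℝ) : HasDerivAt (fun t => (γ t).1 - t) 0 t := by
    have h := hasDerivWithinAt_fst_of_suspension ((hγ t).hasMFDerivWithinAt (s := univ))
    exact (h.hasDerivAt Filter.univ_mem).sub (hasDerivAt_id t) |>.congr_deriv (sub_self 1)
  have hconst := is_const_of_deriv_eq_zero (fun t => (hderiv t).differentiableAt)
    (fun t => (hderiv t).deriv) t 0
  linarith

lemma isIntegralCurve_snd_of_isMIntegralCurve_suspension
    (hγ : IsMIntegralCurve γ (suspension I Y)) (t₀ : ℝ) (h0 : (γ 0).1 = t₀) :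
    IsIntegralCurve I Y fun t => (γ (t - t₀)).2 := by
  intro t
  have hsnd := (hasMFDerivWithinAt_snd_of_suspension
    ((hγ (t - t₀)).hasMFDerivWithinAt (s := univ))).hasMFDerivAt Filter.univ_mem
  rw [fst_eq_add_of_isMIntegralCurve_suspension hγ, h0, add_sub_cancel] at hsnd
  have hshift : HasMFDerivAt 𝓘(ℝ, ℝ) 𝓘(ℝ, ℝ) (fun t : ℝ => t - t₀) t
      (ContinuousLinearMap.id ℝ ℝ : ℝ →L[ℝ] ℝ) :=
    ((hasFDerivAt_id t).sub_const t₀).hasMFDerivAt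
  exact hsnd.comp t hshift

lemma IsIntegralCurve.isMIntegralCurve_suspension {w : ℝ → G} (hw : IsIntegralCurve I Y w) :
    IsMIntegralCurve (fun t => (t, w t)) (suspension I Y) := fun t =>
  (hasMFDerivWithinAt_suspension (s := univ) (θ := fun t => t) (hasDerivWithinAt_id t univ)
    (hw t).hasMFDerivWithinAt).hasMFDerivAt Filter.univ_mem

lemma exists_isMIntegralCurveOn_suspension_add_zsmul {T : ℝ} (hYT : Function.Periodic Y T) (n : ℤ)
    {p : ℝ × G}
    (hp : ∃ γ : ℝ → ℝ × G, γ 0 = p ∧ IsMIntegralCurveOn γ (suspension I Y) s) :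
    ∃ γ : ℝ → ℝ × G, γ 0 = (p.1 + n • T, p.2) ∧ IsMIntegralCurveOn γ (suspension I Y) s := by
  obtain ⟨γ, rfl, hγ⟩ := hp
  refine ⟨fun t => ((γ t).1 + n • T, (γ t).2), rfl, fun t ht => ?_⟩
  refine hasMFDerivWithinAt_suspension (θ := fun s => (γ s).1 + n • T)
    ((hasDerivWithinAt_fst_of_suspension (hγ t ht)).add_const _) ?_
  rw [hYT.zsmul n (γ t).1]
  exact hasMFDerivWithinAt_snd_of_suspension (hγ t ht)

variable [I.Boundaryless] [T2Space G]

lemma IsIntegralCurve.eq_of_contMDiff_suspension [IsManifold I 1 G]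
    (hY : ContMDiff (𝓘(ℝ, ℝ).prod I) (𝓘(ℝ, ℝ).prod I).tangent 1
      (fun p => (⟨p, suspension I Y p⟩ : TangentBundle (𝓘(ℝ, ℝ).prod I) (ℝ × G))))
    {w w' : ℝ → G} (hw : IsIntegralCurve I Y w) (hw' : IsIntegralCurve I Y w') {t₀ : ℝ}
    (h : w t₀ = w' t₀) : w = w' := by
  have hgraph := isMIntegralCurve_Ioo_eq_of_contMDiff_boundaryless (t₀ := t₀) hY
    hw.isMIntegralCurve_suspension hw'.isMIntegralCurve_suspension (by rw [h])
  funext t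
  exact congrArg Prod.snd (congrFun hgraph t)

lemma exists_isMIntegralCurve_suspension [CompleteSpace E] [IsManifold I 2 G] [CompactSpace G]
    (hY : ContMDiff (𝓘(ℝ, ℝ).prod I) (𝓘(ℝ, ℝ).prod I).tangent 1
      (fun p => (⟨p, suspension I Y p⟩ : TangentBundle (𝓘(ℝ, ℝ).prod I) (ℝ × G))))
    {T : ℝ} (hT : 0 < T) (hYT : Function.Periodic Y T) (p : ℝ × G) :
    ∃ γ : ℝ → ℝ × G, γ 0 = p ∧ IsMIntegralCurve γ (suspension I Y) := by
  have : IsManifold I 1 G := .of_le one_le_two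
  obtain ⟨ε, hε, hlocal⟩ := exists_pos_forall_mem_exists_isMIntegralCurveOn hY
    ((isCompact_Icc (a := (0 : ℝ)) (b := T)).prod (isCompact_univ (X := G)))
  refine exists_isMIntegralCurve_of_isMIntegralCurveOn hY hε (fun q => ?_) p
  have hmem : (toIcoMod hT 0 q.1, q.2) ∈ Icc 0 T ×ˢ (univ : Set G) := by
    have h := toIcoMod_mem_Ico hT 0 q.1
    rw [zero_add] at h
    exact ⟨Ico_subset_Icc_self h, mem_univ _⟩
  have h := exists_isMIntegralCurveOn_suspension_add_zsmul hYT (toIcoDiv hT 0 q.1) (hlocal _ hmem)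
  rwa [toIcoMod_add_toIcoDiv_zsmul] at h

lemma exists_isIntegralCurve_of_periodic [CompleteSpace E] [IsManifold I 2 G] [CompactSpace G]
    (hY : ContMDiff (𝓘(ℝ, ℝ).prod I) (𝓘(ℝ, ℝ).prod I).tangent 1
      (fun p => (⟨p, suspension I Y p⟩ : TangentBundle (𝓘(ℝ, ℝ).prod I) (ℝ × G))))
    {T : ℝ} (hT : 0 < T) (hYT : Function.Periodic Y T) (t₀ : ℝ) (x₀ : G) :
    ∃ w : ℝ → G, IsIntegralCurve I Y w ∧ w t₀ = x₀ := by
  obtain ⟨γ, h0, hγ⟩ := exists_isMIntegralCurve_suspension hY hT hYT (t₀, x₀)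
  exact ⟨fun t => (γ (t - t₀)).2,
    isIntegralCurve_snd_of_isMIntegralCurve_suspension hγ t₀ (by rw [h0]), by simp [h0]⟩

end Suspension

section LeftTranslation

variable {E : Type*} [NormedAddCommGroup E] [NormedSpace ℝ E]
  {H : Type*} [TopologicalSpace H] (I : ModelWithCorners ℝ E H)
  {G : Type*} [TopologicalSpace G] [ChartedSpace H G]
  {E' : Type*} [NormedAddCommGroup E'] [NormedSpace ℝ E'] {H' : Type*} [TopologicalSpace H']
  {I' : ModelWithCorners ℝ E' H'} {N : Type*} [TopologicalSpace N] [ChartedSpace H' N]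

lemma contMDiff_tangentBundle_mk_const [IsManifold I 1 G] {n : ℕ∞ω} (x : G) {ξ : N → E}
    (hξ : ContMDiff I' 𝓘(ℝ, E) n ξ) :
    ContMDiff I' I.tangent n (fun p => (⟨x, ξ p⟩ : TangentBundle I G)) := by
  intro p
  rw [Bundle.contMDiffAt_totalSpace]
  refine ⟨contMDiffAt_const, (hξ p).congr_of_eventuallyEq (Filter.Eventually.of_forall fun q => ?_)⟩
  exact tangentCoordChange_self (mem_extChartAt_source x)

variable [Group G] [LieGroup I ∞ G]

lemma mdifferentiable_mul : MDifferentiable (I.prod I) I (fun p : G × G => p.1 * p.2) :=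
  (contMDiff_mul I ∞).mdifferentiable (by simp)

lemma mfderiv_mul_left_mulLeftDeriv (w x : G) (ξ : E) :
    (mfderiv I I (fun y : G => w * y) x : E →L[ℝ] E) (mulLeftDeriv I x ξ) =
      mulLeftDeriv I (w * x) ξ := by
  have hw : MDifferentiableAt I I (fun y : G => w * y) x :=
    (contMDiff_mul_left (n := ∞)).mdifferentiable (by simp) _
  have h := hasMFDerivAt_comp_of_eq hw.hasMFDerivAt (hasMFDerivAt_mul_left I x) (mul_one x)
  have hcomp : (fun y : G => w * y) ∘ (fun y : G => x * y) = fun y => w * x * y := by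
    ext y; simp [mul_assoc]
  rw [hcomp] at h
  exact DFunLike.congr_fun (hasMFDerivAt_unique h (hasMFDerivAt_mul_left I (w * x))) ξ

lemma mfderiv_mul_right_mulLeftDeriv_adRep (w x : G) (η : E) :
    (mfderiv I I (fun y : G => y * x) w : E →L[ℝ] E) (mulLeftDeriv I w (adRep I x η)) =
      mulLeftDeriv I (w * x) η := by
  have hx : MDifferentiableAt I I (fun y : G => y * x) w :=
    (contMDiff_mul_right (n := ∞)).mdifferentiable (by simp) _
  have hwconj : HasMFDerivAt I I ((fun y : G => w * y) ∘ fun y : G => x * y * x⁻¹) (1 : G)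
      ((mulLeftDeriv I w).comp (adRep I x) : E →L[ℝ] E) :=
    hasMFDerivAt_comp_of_eq (hasMFDerivAt_mul_left I w) (mdifferentiable_conj I x 1).hasMFDerivAt
      (by simp)
  have h := hasMFDerivAt_comp_of_eq hx.hasMFDerivAt hwconj (by simp)
  have hcomp : (fun y : G => y * x) ∘ (fun y : G => w * y) ∘ (fun y : G => x * y * x⁻¹) =
      fun y => w * x * y := by
    ext y; simp [mul_assoc]
  rw [hcomp] at h
  exact DFunLike.congr_fun (hasMFDerivAt_unique h (hasMFDerivAt_mul_left I (w * x))) η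

lemma mfderiv_mul_apply (w x : G) (η ξ : E) :
    (mfderiv (I.prod I) I (fun p : G × G => p.1 * p.2) (w, x) : E × E →L[ℝ] E)
      (mulLeftDeriv I w (adRep I x η), mulLeftDeriv I x ξ) = mulLeftDeriv I (w * x) (η + ξ) := by
  rw [map_add, ← mfderiv_mul_left_mulLeftDeriv I w x ξ,
    ← mfderiv_mul_right_mulLeftDeriv_adRep I w x η]
  exact mfderiv_prod_eq_add_apply (mdifferentiable_mul I (w, x))

lemma tangentMap_mul_mk_zero (x : G) (ξ : E) :
    tangentMap (I.prod I) I (fun p : G × G => p.1 * p.2)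
      ((equivTangentBundleProd I G I G).symm (⟨x, (0 : E)⟩, ⟨1, ξ⟩)) =
    ⟨x, mulLeftDeriv I x ξ⟩ := by
  have h := mfderiv_mul_apply I x 1 0 ξ
  rw [map_zero, map_zero, mulLeftDeriv_one, zero_add, mul_one] at h
  exact Bundle.TotalSpace.ext (mul_one x) (heq_of_eq h)

lemma contMDiff_mulLeftDeriv {g : N → G} {ξ : N → E} (hg : ContMDiff I' I ∞ g)
    (hξ : ContMDiff I' 𝓘(ℝ, E) ∞ ξ) :
    ContMDiff I' I.tangent ∞
      (fun p => (⟨g p, mulLeftDeriv I (g p) (ξ p)⟩ : TangentBundle I G)) := by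
  have hzero : ContMDiff I' I.tangent ∞ (fun p => (⟨g p, (0 : E)⟩ : TangentBundle I G)) :=
    (Bundle.contMDiff_zeroSection ℝ (TangentSpace I : G → Type _)).comp hg
  have hone := contMDiff_tangentBundle_mk_const I (1 : G) hξ
  have hpair : ContMDiff (I.tangent.prod I.tangent) (I.prod I).tangent ∞
      (equivTangentBundleProd I G I G).symm := contMDiff_equivTangentBundleProd_symm
  have hmul : ContMDiff (I.prod I).tangent I.tangent ∞
      (tangentMap (I.prod I) I (fun p : G × G => p.1 * p.2)) :=
    (contMDiff_mul I ∞).contMDiff_tangentMap (by simp)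
  exact (hmul.comp (hpair.comp (hzero.prodMk hone))).congr
    fun p => (tangentMap_mul_mk_zero I (g p) (ξ p)).symm

lemma contMDiff_suspension_mulLeftDeriv {ξ : ℝ × G → E}
    (hξ : ContMDiff (𝓘(ℝ, ℝ).prod I) 𝓘(ℝ, E) ∞ ξ) :
    ContMDiff (𝓘(ℝ, ℝ).prod I) (𝓘(ℝ, ℝ).prod I).tangent ∞
      (fun p => (⟨p, suspension I (fun t w => mulLeftDeriv I w (ξ (t, w))) p⟩ :
        TangentBundle (𝓘(ℝ, ℝ).prod I) (ℝ × G))) := by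
  have hone : ContMDiff 𝓘(ℝ, ℝ) 𝓘(ℝ, ℝ).tangent ∞
      (fun t : ℝ => (⟨t, (1 : ℝ)⟩ : TangentBundle 𝓘(ℝ, ℝ) ℝ)) :=
    contMDiff_vectorSpace_iff_contDiff.2 contDiff_const
  have htime := hone.comp (contMDiff_fst (I := 𝓘(ℝ, ℝ)) (J := I) (M := ℝ) (N := G))
  have hspace := contMDiff_mulLeftDeriv I contMDiff_snd hξ
  have hpair : ContMDiff (𝓘(ℝ, ℝ).tangent.prod I.tangent) (𝓘(ℝ, ℝ).prod I).tangent ∞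
      (equivTangentBundleProd 𝓘(ℝ, ℝ) ℝ I G).symm := contMDiff_equivTangentBundleProd_symm
  exact hpair.comp (htime.prodMk hspace)

lemma hasMFDerivAt_mul_of_mulLeftDeriv {w x : ℝ → G} {t : ℝ} {η ξ : E}
    (hw : HasMFDerivAt 𝓘(ℝ, ℝ) I w t
      ((1 : ℝ →L[ℝ] ℝ).smulRight (mulLeftDeriv I (w t) (adRep I (x t) η)) : ℝ →L[ℝ] E))
    (hx : HasMFDerivAt 𝓘(ℝ, ℝ) I x t
      ((1 : ℝ →L[ℝ] ℝ).smulRight (mulLeftDeriv I (x t) ξ) : ℝ →L[ℝ] E)) :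
    HasMFDerivAt 𝓘(ℝ, ℝ) I (fun s => w s * x s) t
      ((1 : ℝ →L[ℝ] ℝ).smulRight (mulLeftDeriv I (w t * x t) (η + ξ)) : ℝ →L[ℝ] E) := by
  refine ((mdifferentiable_mul I (w t, x t)).hasMFDerivAt.comp t (hw.prodMk hx)).congr_mfderiv ?_
  rw [← mfderiv_mul_apply]
  let L : E × E →L[ℝ] E := mfderiv (I.prod I) I (fun p : G × G => p.1 * p.2) (w t, x t)
  let v : E := mulLeftDeriv I (w t) (adRep I (x t) η)
  let v' : E := mulLeftDeriv I (x t) ξ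
  change L.comp (((1 : ℝ →L[ℝ] ℝ).smulRight v).prod ((1 : ℝ →L[ℝ] ℝ).smulRight v')) =
    (1 : ℝ →L[ℝ] ℝ).smulRight (L (v, v'))
  ext
  simp

end LeftTranslation

section Tracking

open Filter

variable {E : Type*} [NormedAddCommGroup E] [NormedSpace ℝ E]
  {H : Type*} [TopologicalSpace H] (I : ModelWithCorners ℝ E H)
  {G : Type*} [TopologicalSpace G] [ChartedSpace H G] [Group G]
  {m : ℕ} (X : Fin m → GroupLieAlgebra I G) {xr w : ℝ → G} {ur : Fin m → ℝ → ℝ} {T : ℝ}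

lemma sum_smul_mulInvariantVectorField (c : Fin m → ℝ) (x : G) :
    ∑ k, c k • mulInvariantVectorField (X k) x = mulLeftDeriv I x (∑ k, c k • (X k : E)) := by
  have h (L : E →L[ℝ] E) (v : Fin m → E) : ∑ k, c k • L (v k) = L (∑ k, c k • v k) := by
    simp only [map_sum, map_smul]
  exact h (mulLeftDeriv I x) X

lemma IsTrajectory.hasMFDerivAt (h : IsTrajectory I X xr ur) (t : ℝ) :
    HasMFDerivAt 𝓘(ℝ, ℝ) I xr t ((1 : ℝ →L[ℝ] ℝ).smulRight
      (mulLeftDeriv I (xr t) (∑ k, ur k t • (X k : E))) : ℝ →L[ℝ] E) := by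
  rw [← sum_smul_mulInvariantVectorField]
  exact h.integralCurve t

lemma periodic_auxField (h : Function.Periodic xr T) :
    Function.Periodic (auxField I X xr) T := fun t => by
  funext w
  simp only [auxField, auxCoeff, h t]

variable [LieGroup I ∞ G]

lemma contDiff_adRep_comp {γ : ℝ → G} {Y : ℝ → E}
    (hγ : ∀ t, HasMFDerivAt 𝓘(ℝ, ℝ) I γ t
      ((1 : ℝ →L[ℝ] ℝ).smulRight (mulLeftDeriv I (γ t) (Y t)) : ℝ →L[ℝ] E))
    (hY : ∀ n : ℕ, ContDiff ℝ n (fun t => adRep I (γ t)) → ContDiff ℝ n Y) :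
    ContDiff ℝ ∞ (fun t => adRep I (γ t)) :=
  contDiff_infty_of_hasDerivAt (fun t => hasDerivAt_adRep_comp I (hγ t)) fun n hn =>
    hn.mul ((adDeriv I G).contDiff.comp (hY n hn))

lemma IsTrajectory.contDiff_adRep (h : IsTrajectory I X xr ur) :
    ContDiff ℝ ∞ (fun t => adRep I (xr t)) :=
  contDiff_adRep_comp I (h.hasMFDerivAt I X) fun n _ => ContDiff.sum fun k _ =>
    ((h.smooth k).of_le (by exact_mod_cast le_top)).smul contDiff_const

/-- The vectors `Ad (xr t) Xₖ`, typed by the model space. -/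
def controlDirections (xr : ℝ → G) (t : ℝ) (k : Fin m) : E := adRep I (xr t) (X k : E)

variable {I X} in
lemma contDiff_controlDirections {n : ℕ∞ω} (hxr : ContDiff ℝ n (fun t => adRep I (xr t))) :
    ContDiff ℝ n (controlDirections I X xr) :=
  contDiff_pi.2 fun _ => hxr.clm_apply contDiff_const

lemma periodic_controlDirections (h : Function.Periodic xr T) :
    Function.Periodic (controlDirections I X xr) T := fun t => by
  funext k
  simp only [controlDirections, h t]

variable [FiniteDimensional ℝ E]

/-- The vector that the left translation by `w` takes to the auxiliary field at `(t, w)`, as a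
function of `B = Ad w`, which lives in a fixed normed algebra. -/
def auxVector (xr : ℝ → G) (t : ℝ) (B : E →L[ℝ] E) : E :=
  feedback (mulPairing (traceCLM E) (adDeriv I G)) (controlDirections I X xr t) B

lemma auxVector_eq_adRep (xr : ℝ → G) (t : ℝ) (x : G) :
    auxVector I X xr t (adRep I x) =
      adRep I (xr t) (∑ k, auxCoeff I X xr k t x • (X k : E)) := by
  have h (L : E →L[ℝ] E) (c : Fin m → ℝ) (v : Fin m → E) :
      L (∑ k, c k • v k) = ∑ k, c k • L (v k) := by
    simp only [map_sum, map_smul]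
  simp only [auxCoeff_eq_traceCLM]
  exact (h (adRep I (xr t)) _ X).symm

lemma auxField_eq_mulLeftDeriv (xr : ℝ → G) :
    auxField I X xr = fun t w => mulLeftDeriv I w (auxVector I X xr t (adRep I w)) := by
  funext t w
  simp only [auxField, auxCoeff_eq_traceCLM]
  exact sum_smul_mulInvariantVectorField I (fun k => Ad I (xr t) (X k)) _ w

variable {I X}

lemma auxField_eq_zero_of_isLyapunovCritical {y : G} (hy : IsLyapunovCritical I y) (xr : ℝ → G)
    (t : ℝ) : auxField I X xr t y = 0 := by
  have hpairing : mulPairing (traceCLM E) (adDeriv I G) (adRep I y) = 0 := hy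
  have hvec : auxVector I X xr t (adRep I y) = 0 := by
    simp only [auxVector, feedback, hpairing, zero_apply, zero_smul,
      Finset.sum_const_zero]
  rw [auxField_eq_mulLeftDeriv]
  exact (congrArg (mulLeftDeriv I y) hvec).trans (map_zero (mulLeftDeriv I y))

lemma IsIntegralCurve.hasMFDerivAt_auxVector (hw : IsIntegralCurve I (auxField I X xr) w)
    (t : ℝ) : HasMFDerivAt 𝓘(ℝ, ℝ) I w t
      ((1 : ℝ →L[ℝ] ℝ).smulRight (mulLeftDeriv I (w t) (auxVector I X xr t (adRep I (w t)))) :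
        ℝ →L[ℝ] E) := by
  rw [auxField_eq_mulLeftDeriv] at hw
  exact hw t

lemma IsIntegralCurve.hasDerivAt_adRep (hw : IsIntegralCurve I (auxField I X xr) w) (t : ℝ) :
    HasDerivAt (fun s => adRep I (w s))
      (adRep I (w t) * adDeriv I G (auxVector I X xr t (adRep I (w t)))) t :=
  hasDerivAt_adRep_comp I (hw.hasMFDerivAt_auxVector t)

lemma IsIntegralCurve.monotone_lyapunov (hw : IsIntegralCurve I (auxField I X xr) w) :
    Monotone (lyapunov I ∘ w) :=
  monotone_of_hasDerivAt_mul_feedback (τ := traceCLM E) hw.hasDerivAt_adRep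

lemma IsIntegralCurve.tendsto_mulPairing_zero [CompactSpace G] (hT : 0 < T)
    (hper : Function.Periodic xr T) (hxr : Continuous fun t => adRep I (xr t))
    (hreg : IsRegular I X xr) (hw : IsIntegralCurve I (auxField I X xr) w) (Z : E) :
    Tendsto (fun t => mulPairing (traceCLM E) (adDeriv I G) (adRep I (w t)) Z) atTop (𝓝 0) :=
  tendsto_mulPairing_zero_of_mem_span (Y := controlDirections I X xr) hw.hasDerivAt_adRep
    (isCompact_range (contMDiff_adRep I).continuous) (fun t => ⟨w t, rfl⟩) hT
    (periodic_controlDirections I X hper)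
    (contDiff_zero.1 (contDiff_controlDirections (contDiff_zero.2 hxr)))
    (hreg.ge (Submodule.mem_top (x := (Z : GroupLieAlgebra I G))))

lemma IsIntegralCurve.isLyapunovCritical_of_mapClusterPt [CompactSpace G] (hT : 0 < T)
    (hper : Function.Periodic xr T) (hxr : Continuous fun t => adRep I (xr t))
    (hreg : IsRegular I X xr) (hw : IsIntegralCurve I (auxField I X xr) w) {y : G}
    (hy : MapClusterPt y atTop w) : IsLyapunovCritical I y := by
  ext Z
  have hcont : Continuous fun x : G => mulPairing (traceCLM E) (adDeriv I G) (adRep I x) Z :=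
    (((mulPairing _ _).continuous.comp (contMDiff_adRep I).continuous)).clm_apply continuous_const
  have hcluster := MapClusterPt.tendsto_comp
    (f := fun x => mulPairing (traceCLM E) (adDeriv I G) (adRep I x) Z) hcont.continuousAt hy
  exact eq_of_nhds_neBot
    (hcluster.clusterPt.mono (hw.tendsto_mulPairing_zero hT hper hxr hreg Z))

lemma contMDiff_suspension_auxField (hxr : ContDiff ℝ ∞ (fun t => adRep I (xr t))) :
    ContMDiff (𝓘(ℝ, ℝ).prod I) (𝓘(ℝ, ℝ).prod I).tangent ∞
      (fun p => (⟨p, suspension I (auxField I X xr) p⟩ :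
        TangentBundle (𝓘(ℝ, ℝ).prod I) (ℝ × G))) := by
  have hfeedback : ContMDiff 𝓘(ℝ, (Fin m → E) × (E →L[ℝ] E)) 𝓘(ℝ, E) ∞
      fun p : (Fin m → E) × (E →L[ℝ] E) =>
        feedback (mulPairing (traceCLM E) (adDeriv I G)) p.1 p.2 :=
    (contDiff_feedback _).contMDiff
  have hdir : ContMDiff (𝓘(ℝ, ℝ).prod I) 𝓘(ℝ, Fin m → E) ∞
      fun p : ℝ × G => controlDirections I X xr p.1 :=
    (contDiff_controlDirections hxr).contMDiff.comp contMDiff_fst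
  have hAd : ContMDiff (𝓘(ℝ, ℝ).prod I) 𝓘(ℝ, E →L[ℝ] E) ∞ fun p : ℝ × G => adRep I p.2 :=
    (contMDiff_adRep I).comp contMDiff_snd
  rw [auxField_eq_mulLeftDeriv]
  exact contMDiff_suspension_mulLeftDeriv I (hfeedback.comp (hdir.prodMk_space hAd))

lemma existsUnique_isIntegralCurve_auxField [I.Boundaryless] [T2Space G] [CompactSpace G]
    (hT : 0 < T) (hper : Function.Periodic xr T) (hxr : ContDiff ℝ ∞ (fun t => adRep I (xr t)))
    (t₀ : ℝ) (x₀ : G) :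
    ∃! w : ℝ → G, IsIntegralCurve I (auxField I X xr) w ∧ w t₀ = x₀ := by
  have : IsManifold I 1 G := .of_le (n := ∞) (by exact_mod_cast le_top)
  have : IsManifold I 2 G := .of_le (n := ∞) ENat.LEInfty.out
  have hsmooth := (contMDiff_suspension_auxField (X := X) hxr).of_le
    (show (1 : ℕ∞ω) ≤ ∞ by exact_mod_cast le_top)
  obtain ⟨w, hw, hw0⟩ :=
    exists_isIntegralCurve_of_periodic hsmooth hT (periodic_auxField I X hper) t₀ x₀
  exact ⟨w, ⟨hw, hw0⟩, fun w' hw' =>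
    hw'.1.eq_of_contMDiff_suspension hsmooth hw (hw'.2.trans hw0.symm)⟩

theorem isLocalAttractor_auxField [I.Boundaryless] [T2Space G] [CompactSpace G]
    (hcenter : LieAlgebra.center ℝ (GroupLieAlgebra I G) = ⊥) (hT : 0 < T)
    (hper : Function.Periodic xr T) (hxr : ContDiff ℝ ∞ (fun t => adRep I (xr t)))
    (hreg : IsRegular I X xr) {z : G} (hz : Ad I z = LinearMap.id) :
    IsLocalAttractor I (auxField I X xr) z := by
  have hcrit : IsLyapunovCritical I z :=
    isLyapunovCritical_of_lyapunov_eq_finrank I (lyapunov_eq_finrank_of_Ad_eq_id I hz)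
  obtain ⟨K, hK, hKz, U, hU, htrap⟩ := exists_isCompact_trapping I hcenter hz
  refine ⟨auxField_eq_zero_of_isLyapunovCritical hcrit xr, U, hU, fun t₀ x₀ hx₀ =>
    ⟨existsUnique_isIntegralCurve_auxField hT hper hxr t₀ x₀, fun w hw hw0 => ?_⟩⟩
  have hwcont : Continuous w := continuous_iff_continuousAt.2 fun t => (hw t).continuousAt
  have hwK := htrap w hwcont hw.monotone_lyapunov t₀ (hw0 ▸ hx₀)
  exact hK.tendsto_nhds_of_unique_mapClusterPt (eventually_atTop.2 ⟨t₀, hwK⟩) fun y hy hcluster =>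
    hKz y hy (hw.isLyapunovCritical_of_mapClusterPt hT hper hxr.continuous hreg hcluster)

lemma contDiff_auxCoeff_comp (hxr : ContDiff ℝ ∞ (fun t => adRep I (xr t)))
    (hw : IsIntegralCurve I (auxField I X xr) w) (k : Fin m) :
    ContDiff ℝ ∞ fun t => auxCoeff I X xr k t (w t) := by
  have hY : ContDiff ℝ ∞ (controlDirections I X xr) := contDiff_controlDirections hxr
  have hAd : ContDiff ℝ ∞ (fun t => adRep I (w t)) :=
    contDiff_adRep_comp I hw.hasMFDerivAt_auxVector fun n hn =>
      (contDiff_feedback _).comp ((hY.of_le (by exact_mod_cast le_top)).prodMk hn)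
  simp only [auxCoeff_eq_traceCLM]
  exact (traceCLM E).contDiff.comp
    (hAd.mul ((adDeriv I G).contDiff.comp (contDiff_pi.1 hY k)))

theorem IsTrajectory.mul_isIntegralCurve (h : IsTrajectory I X xr ur)
    (hw : IsIntegralCurve I (auxField I X xr) w) :
    IsTrajectory I X (fun t => w t * xr t) (fun k t => auxCoeff I X xr k t (w t) + ur k t) := by
  refine ⟨fun k => (contDiff_auxCoeff_comp (h.contDiff_adRep I X) hw k).add (h.smooth k),
    fun t => ?_⟩
  have hw' := hw.hasMFDerivAt_auxVector t
  rw [auxVector_eq_adRep] at hw'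
  have hadd (c d : Fin m → ℝ) (v : Fin m → E) :
      ∑ k, c k • v k + ∑ k, d k • v k = ∑ k, (c k + d k) • v k := by
    simp only [add_smul, Finset.sum_add_distrib]
  have hvelocity := (congrArg (mulLeftDeriv I (w t * xr t))
    (hadd (fun k => auxCoeff I X xr k t (w t)) (fun k => ur k t) X)).trans
      (sum_smul_mulInvariantVectorField I X _ _).symm
  exact (hasMFDerivAt_mul_of_mulLeftDeriv I hw' (h.hasMFDerivAt I X t)).congr_mfderiv
    (congrArg (fun v : E => (1 : ℝ →L[ℝ] ℝ).smulRight v) hvelocity)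

theorem exists_nhds_forall_solvesTracking
    (h : IsTrajectory I X xr ur) (hatt : IsLocalAttractor I (auxField I X xr) (1 : G)) :
    ∃ U ∈ 𝓝 (xr 0), ∀ x₀ ∈ U,
      (∃! w : ℝ → G, IsIntegralCurve I (auxField I X xr) w ∧ w 0 = x₀ * (xr 0)⁻¹) ∧
      ∀ w : ℝ → G, IsIntegralCurve I (auxField I X xr) w → w 0 = x₀ * (xr 0)⁻¹ →
        SolvesTracking I X xr x₀ (fun t => w t * xr t)
          (fun k t => auxCoeff I X xr k t (w t) + ur k t) := by
  have := topologicalGroup_of_lieGroup I ∞ (G := G)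
  obtain ⟨-, U, hU, hflow⟩ := hatt
  refine ⟨(· * (xr 0)⁻¹) ⁻¹' U, (continuous_mul_const _).continuousAt.preimage_mem_nhds
    (by rwa [mul_inv_cancel]), fun x₀ hx₀ => ?_⟩
  obtain ⟨hex, hlim⟩ := hflow 0 _ hx₀
  refine ⟨hex, fun w hw hw0 => ⟨h.mul_isIntegralCurve hw, by simp [hw0], ?_⟩⟩
  simpa using hlim w hw hw0

end Tracking

end

end TrajectoryTracking

open TrajectoryTracking in
theorem mainTheorem1_general
    {E : Type*} [NormedAddCommGroup E] [NormedSpace ℝ E] [FiniteDimensional ℝ E]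
    {H : Type*} [TopologicalSpace H] (I : ModelWithCorners ℝ E H) [I.Boundaryless]
    {G : Type*} [TopologicalSpace G] [ChartedSpace H G] [Group G] [LieGroup I ∞ G]
    [T2Space G] [CompactSpace G]
    (hcenter : LieAlgebra.center ℝ (GroupLieAlgebra I G) = ⊥)
    {m : ℕ} (X : Fin m → GroupLieAlgebra I G)
    (T : ℝ) (hT : 0 < T) (xr : ℝ → G) (ur : Fin m → ℝ → ℝ)
    (htraj : IsTrajectory I X xr ur) (hper : Function.Periodic xr T) (hreg : IsRegular I X xr) :
    (∀ z, Ad I z = LinearMap.id → IsLocalAttractor I (auxField I X xr) z) ∧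
    ∃ U ∈ 𝓝 (xr 0), ∀ x₀ ∈ U,
      (∃! w : ℝ → G, IsIntegralCurve I (auxField I X xr) w ∧ w 0 = x₀ * (xr 0)⁻¹) ∧
      ∀ w : ℝ → G, IsIntegralCurve I (auxField I X xr) w → w 0 = x₀ * (xr 0)⁻¹ →
        SolvesTracking I X xr x₀ (fun t => w t * xr t)
          (fun k t => auxCoeff I X xr k t (w t) + ur k t) := by
  have hatt : ∀ z, Ad I z = LinearMap.id → IsLocalAttractor I (auxField I X xr) z := fun z hz =>
    isLocalAttractor_auxField hcenter hT hper (htraj.contDiff_adRep I X) hreg hz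
  exact ⟨hatt, exists_nhds_forall_solvesTracking htraj
    (hatt 1 (Ad_eq_id_of_mem_center I (one_mem _)))⟩

theorem mainTheorem1
    {E : Type*} [NormedAddCommGroup E] [NormedSpace ℝ E] [FiniteDimensional ℝ E]
    {H : Type*} [TopologicalSpace H] (I : ModelWithCorners ℝ E H) [I.Boundaryless]
    {G : Type*} [TopologicalSpace G] [ChartedSpace H G] [Group G] [LieGroup I ∞ G]
    [T2Space G] [CompactSpace G] [ConnectedSpace G]
    -- `G` is semisimple: its Lie algebra has no nonzero solvable ideal
    [LieAlgebra.HasTrivialRadical ℝ (GroupLieAlgebra I G)]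
    {m : ℕ} (X : Fin m → GroupLieAlgebra I G)
    -- the regular `T`-periodic reference trajectory
    (T : ℝ) (hT : 0 < T) (xr : ℝ → G) (ur : Fin m → ℝ → ℝ)
    (htraj : TrajectoryTracking.IsTrajectory I X xr ur)
    (hper : TrajectoryTracking.IsPeriodicTrajectory T xr ur)
    (hreg : TrajectoryTracking.IsRegular I X xr) :
    (∀ z ∈ Subgroup.center G,
      TrajectoryTracking.IsLocalAttractor I (TrajectoryTracking.auxField I X xr) z) ∧
    TrajectoryTracking.IsLocalAttractor I (TrajectoryTracking.auxField I X xr) (1 : G) ∧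
    ∃ U ∈ 𝓝 (xr 0), ∀ x₀ ∈ U,
      (∃! w : ℝ → G,
        TrajectoryTracking.IsIntegralCurve I (TrajectoryTracking.auxField I X xr) w ∧
          w 0 = x₀ * (xr 0)⁻¹) ∧
      ∀ w : ℝ → G,
        TrajectoryTracking.IsIntegralCurve I (TrajectoryTracking.auxField I X xr) w →
        w 0 = x₀ * (xr 0)⁻¹ →
        TrajectoryTracking.SolvesTracking I X xr x₀ (fun t => w t * xr t)
          (fun k t => TrajectoryTracking.auxCoeff I X xr k t (w t) + ur k t) := by
  obtain ⟨hatt, htrack⟩ := mainTheorem1_general I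
    (LieAlgebra.center_eq_bot ℝ (GroupLieAlgebra I G)) X T hT xr ur htraj hper.1 hreg
  exact ⟨fun z hz => hatt z (TrajectoryTracking.Ad_eq_id_of_mem_center I hz),
    hatt 1 (TrajectoryTracking.Ad_eq_id_of_mem_center I (one_mem _)), htrack⟩
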